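/- Setting. Let $\mathrm U,\mathrm V$ be real Banach spaces, $T>0$, $2\le p<3$, $p-2<\gamma\le 1$ and $\varpi(\delta):=\delta^{(2+\gamma)/p}$. Let $\omega$ be a control: $\omega_{s,t}\ge 0$ for $0\le s\le t\le T$, $\omega_{r,s}+\omega_{s,t}\le\omega_{r,t}$ for $r\le s\le t$, $\omega_{s,s}=0$, and $\omega$ is continuous at the diagonal. Let $\mathbf x=(\mathbf x^{(1)},\mathbf x^{(2)})$ be a $p$-rough path controlled by $\omega$, with $\mathbf x^{(1)}_{s,t}\in\mathrm U$ and $\mathbf x^{(2)}_{s,t}\in\mathrm U\hat\otimes_\pi\mathrm U$ (completed projective tensor product): for $0\le r\le s\le t\le T$, $$\mathbf x^{(1)}_{r,t}=\mathbf x^{(1)}_{r,s}+\mathbf x^{(1)}_{s,t},\qquad \mathbf x^{(2)}_{r,t}=\mathbf x^{(2)}_{r,s}+\mathbf x^{(2)}_{s,t}+\mathbf x^{(1)}_{r,s}\otimes\mathbf x^{(1)}_{s,t},\qquad |\mathbf x^{(k)}_{s,t}|\le C\omega_{s,t}^{k/p}\ (k=1,2)$$ for some constant $C$. Let $f:\mathrm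 V\to L(\mathrm U,\mathrm V)$ be of class $\mathcal C^{2+\gamma}_b$: $f$ is $C^2$, $f,\mathrm df,\mathrm d^2f$ are bounded and $\mathrm d^2f$ is $\gamma$-Hölder. The Davie expansion is $$\phi_{t,s}(a)=a+f(a)\mathbf x^{(1)}_{s,t}+\mathrm df(a)\cdot f(a)\,\mathbf x^{(2)}_{s,t},\qquad 0\le s\le t\le T,\ a\in\mathrm V,$$ where $\mathrm df(a)\cdot f(a)\,(u\otimes v)=(\mathrm df(a)(f(a)u))v$. Definitions. A family $(\chi_{t,s})_{0\le s\le t\le T}$ of continuous maps $\mathrm V\to\mathrm V$ is an almost flow if $\chi_{t,t}=\mathrm{id}$ and there are a non-decreasing $\delta:\mathbb R_+\to\mathbb R_+$ with $\delta_{T'}\to0$ as $T'\to0$, a continuous non-decreasing $\eta:\mathbb R_+\to\mathbb R_+$, $\gamma'\in(0,1]$ and $M\ge0$ such that, for all $0<T'\le T$, all $0\le r\le s\le t\le T'$ and all $a,b\in\mathrm V$: $\eta(\omega_{s,t})\varpi(\omega_{s,t})^{\gamma'}\le\delta_{T'}\varpi(\omega_{s,t})$, $|\chi_{t,s}(a)-a|\le\delta_{T'}$,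 $|\chi_{t,s}(b)-\chi_{t,s}(a)|\le(1+\delta_{T'})|b-a|+\eta(\omega_{s,t})|b-a|^{\gamma'}$ and $|\chi_{t,s}(\chi_{s,r}(a))-\chi_{t,r}(a)|\le M\varpi(\omega_{r,t})$. Two families $\chi,\zeta$ are in the same galaxy if $\sup_a|\chi_{t,s}(a)-\zeta_{t,s}(a)|\le C\varpi(\omega_{s,t})$ for some constant $C$ and all $0\le s\le t\le T$. A flow is a family $(\psi_{t,s})_{s,t\in[0,T]}$ of maps $\mathrm V\to\mathrm V$ with $\psi_{t,t}=\mathrm{id}$, $\psi_{t,s}\circ\psi_{s,r}=\psi_{t,r}$ whenever $r\le s\le t$ or $r\ge s\ge t$, and $\psi_{t,s}$ invertible with inverse $\psi_{s,t}$; it is Lipschitz if all $\psi_{t,s}$ are Lipschitz with a common constant. For a partition $\pi$ of $[0,T]$, $\chi^\pi_{t,s}:=\chi_{t,t_j}\circ\chi_{t_j,t_{j-1}}\circ\dots\circ\chi_{t_{i+1},t_i}\circ\chi_{t_i,s}$, where $t_i\le\dots\le t_j$ are the points of $\pi$ in $[s,t]$ (and $\chi^\pi_{t,s}:=\chi_{t,s}$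 if there are none). We say that $\chi^\pi$ converges to $\psi$ if $\chi^\pi_{t,s}(a)\to\psi_{t,s}(a)$ as the mesh of $\pi$ tends to $0$, uniformly in $a\in\mathrm V$ and $0\le s\le t\le T$. A manifold of solutions to $\dot y=\phi'(y)$ is a family of paths $(y_{r\curvearrowright t}(a))_{r\le t\le T}$, $r\in[0,T]$, $a\in\mathrm V$, such that $y_{r\curvearrowright r}(a)=a$ and, for each $r$ and $a$, there is a constant $C$ with $|y_{r\curvearrowright t}(a)-\phi_{t,s}(y_{r\curvearrowright s}(a))|\le C\varpi(\omega_{s,t})$ for all $r\le s\le t\le T$. It is Lipschitz if $a\mapsto y_{r\curvearrowright\cdot}(a)$ is Lipschitz from $\mathrm V$ to $(\mathcal C([r,T],\mathrm V),\|\cdot\|_\infty)$, uniformly in $r$. Corollary. Under these assumptions $\phi$ is an almost flow, and: (1) there is a Lipschitz flow $\psi$ in the galaxy of $\phi$ such that $\phi^\pi$ converges to $\psi$, and $\psi$ is the only flow in the galaxy of $\phi$; (2) for every almost flow $\chi$ in the galaxy of $\phi$, $\chi^\pi$ converges to the same flow $\psi$; (3) there exists one and only one manifold of solutions to $\dot y=\phi'(y)$,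 and it is Lipschitz. -/

import Mathlib

open scoped TensorProduct NNReal

noncomputable section

namespace RoughFlow

/-! Time-indexed families are functions of real times of which only the values at times in `[0,T]`
matter.  The value `φ t s` of a two-parameter family is the map usually written `φ_{t,s}`. -/

/-- A control on `{0 ≤ s ≤ t ≤ T}`: nonnegative, super-additive, zero on the diagonal and
continuous at every point of the diagonal. -/
structure IsControl (T : ℝ) (ω : ℝ → ℝ → ℝ) : Prop where
  nonneg : ∀ s t, 0 ≤ s → s ≤ t → t ≤ T → 0 ≤ ω s t
  superadditive : ∀ r s t, 0 ≤ r → r ≤ s → s ≤ t → t ≤ T → ω r s + ω s t ≤ ω r t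
  diag : ∀ s, 0 ≤ s → s ≤ T → ω s s = 0
  continuous_diag : ∀ r, 0 ≤ r → r ≤ T →
    ContinuousWithinAt (fun q : ℝ × ℝ => ω q.1 q.2)
      {q : ℝ × ℝ | 0 ≤ q.1 ∧ q.1 ≤ q.2 ∧ q.2 ≤ T} (r, r)

/-- The remainder `ϖ(δ) = δ ^ ((2 + γ) / p)`. -/
def remainder (p γ : ℝ) (δ : ℝ) : ℝ := δ ^ ((2 + γ) / p)

section Families

variable {V : Type*} [NormedAddCommGroup V]

/-- `φ` is an almost flow on `[0,T]` with respect to the control `ω` and the remainder `ϖ`.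
Here `δ` is the modulus `T' ↦ δ_{T'}`, and the estimates hold on `[0,T']` for every horizon
`0 < T' ≤ T`. -/
def IsAlmostFlow (T : ℝ) (ω : ℝ → ℝ → ℝ) (ϖ : ℝ → ℝ) (φ : ℝ → ℝ → V → V) : Prop :=
  (∀ s t, 0 ≤ s → s ≤ t → t ≤ T → Continuous (φ t s)) ∧
  (∀ t, 0 ≤ t → t ≤ T → φ t t = id) ∧
  ∃ (δ η : ℝ → ℝ) (γ M : ℝ),
    (∀ u, 0 ≤ u → 0 ≤ δ u) ∧ MonotoneOn δ (Set.Ici 0) ∧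
    Filter.Tendsto δ (nhdsWithin 0 (Set.Ioi 0)) (nhds 0) ∧
    (∀ u, 0 ≤ u → 0 ≤ η u) ∧ MonotoneOn η (Set.Ici 0) ∧ ContinuousOn η (Set.Ici 0) ∧
    0 < γ ∧ γ ≤ 1 ∧ 0 ≤ M ∧
    ∀ T', 0 < T' → T' ≤ T →
      (∀ s t, 0 ≤ s → s ≤ t → t ≤ T' →
        η (ω s t) * ϖ (ω s t) ^ γ ≤ δ T' * ϖ (ω s t)) ∧
      (∀ s t, 0 ≤ s → s ≤ t → t ≤ T' → ∀ a, ‖φ t s a - a‖ ≤ δ T') ∧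
      (∀ s t, 0 ≤ s → s ≤ t → t ≤ T' → ∀ a b,
        ‖φ t s b - φ t s a‖ ≤ (1 + δ T') * ‖b - a‖ + η (ω s t) * ‖b - a‖ ^ γ) ∧
      (∀ r s t, 0 ≤ r → r ≤ s → s ≤ t → t ≤ T' → ∀ a,
        ‖φ t s (φ s r a) - φ t r a‖ ≤ M * ϖ (ω r t))

/-- `φ` and `ψ` lie in the same galaxy: they are at finite distance relative to `ϖ(ω)`. -/
def SameGalaxy (T : ℝ) (ω : ℝ → ℝ → ℝ) (ϖ : ℝ → ℝ) (φ ψ : ℝ → ℝ → V → V) : Prop :=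
  ∃ C : ℝ, ∀ s t, 0 ≤ s → s ≤ t → t ≤ T → ∀ a, ‖φ t s a - ψ t s a‖ ≤ C * ϖ (ω s t)

/-- A (two-sided, invertible) flow on `[0,T]`. -/
structure IsFlow (T : ℝ) (ψ : ℝ → ℝ → V → V) : Prop where
  refl : ∀ t ∈ Set.Icc 0 T, ψ t t = id
  comp : ∀ r ∈ Set.Icc 0 T, ∀ s ∈ Set.Icc 0 T, ∀ t ∈ Set.Icc 0 T,
    (r ≤ s ∧ s ≤ t) ∨ (t ≤ s ∧ s ≤ r) → ψ t s ∘ ψ s r = ψ t r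
  inv : ∀ s ∈ Set.Icc 0 T, ∀ t ∈ Set.Icc 0 T,
    Function.LeftInverse (ψ s t) (ψ t s) ∧ Function.RightInverse (ψ s t) (ψ t s)

/-- All maps of the family are Lipschitz, with a common constant. -/
def IsLipschitzFamily (T : ℝ) (ψ : ℝ → ℝ → V → V) : Prop :=
  ∃ L : ℝ≥0, ∀ s ∈ Set.Icc 0 T, ∀ t ∈ Set.Icc 0 T, LipschitzWith L (ψ t s)

/-- A partition `0 = t₀ ≤ t₁ ≤ ⋯ ≤ tₙ = T` of `[0,T]`. -/
structure Partition (T : ℝ) where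
  n : ℕ
  pt : Fin (n + 1) → ℝ
  mono : Monotone pt
  first : pt 0 = 0
  last : pt (Fin.last n) = T

/-- The mesh of a partition: its largest step. -/
def Partition.mesh {T : ℝ} (π : Partition T) : ℝ :=
  ⨆ i : Fin π.n, (π.pt i.succ - π.pt i.castSucc)

/-- `chain φ t s [r₁, …, rₖ] = φ_{t,rₖ} ∘ ⋯ ∘ φ_{r₂,r₁} ∘ φ_{r₁,s}`, and
`chain φ t s [] = φ_{t,s}`. -/
def chain (φ : ℝ → ℝ → V → V) (t : ℝ) : ℝ → List ℝ → V → V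
  | s, [] => φ t s
  | s, r :: l => chain φ t r l ∘ φ r s

/-- The iterated product `φ^π_{t,s}`, the composition of `φ` along the points of `π` in `[s,t]`. -/
def iterated {T : ℝ} (φ : ℝ → ℝ → V → V) (π : Partition T) (t s : ℝ) : V → V :=
  chain φ t s ((List.ofFn π.pt).filter fun r => s ≤ r ∧ r ≤ t)

/-- `φ^π_{t,s}(a)` converges to `ψ_{t,s}(a)` as the mesh of `π` tends to zero, uniformly in
`0 ≤ s ≤ t ≤ T` and in `a`. -/
def IteratedConverges (T : ℝ) (φ ψ : ℝ → ℝ → V → V) : Prop :=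
  ∀ ε > 0, ∃ ρ > 0, ∀ π : Partition T, π.mesh ≤ ρ →
    ∀ s t, 0 ≤ s → s ≤ t → t ≤ T → ∀ a, ‖iterated φ π t s a - ψ t s a‖ ≤ ε

/-- The path `y` on `[r,T]` solves `ẏ = φ'(y)` in the sense of Davie, started from `a` at
time `r`. -/
def IsDavieSolution (T : ℝ) (ω : ℝ → ℝ → ℝ) (ϖ : ℝ → ℝ) (φ : ℝ → ℝ → V → V)
    (r : ℝ) (a : V) (y : ℝ → V) : Prop :=
  y r = a ∧
  ∃ C : ℝ, ∀ s t, r ≤ s → s ≤ t → t ≤ T → ‖y t - φ t s (y s)‖ ≤ C * ϖ (ω s t)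

/-- A manifold of solutions: `y r a` is a solution started from `a` at time `r`, for all `r`
and `a`. -/
def IsSolutionManifold (T : ℝ) (ω : ℝ → ℝ → ℝ) (ϖ : ℝ → ℝ) (φ : ℝ → ℝ → V → V)
    (y : ℝ → V → ℝ → V) : Prop :=
  ∀ r, 0 ≤ r → r ≤ T → ∀ a, IsDavieSolution T ω ϖ φ r a (y r a)

/-- `a ↦ y r a` is Lipschitz from `V` to the continuous paths on `[r,T]` with the supremum norm,
uniformly in `r`. -/
def IsLipschitzManifold (T : ℝ) (y : ℝ → V → ℝ → V) : Prop :=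
  (∀ r, 0 ≤ r → r ≤ T → ∀ a, ContinuousOn (y r a) (Set.Icc r T)) ∧
  ∃ L : ℝ, ∀ r, 0 ≤ r → r ≤ T → ∀ a b, ∀ t, r ≤ t → t ≤ T →
    ‖y r a t - y r b t‖ ≤ L * ‖a - b‖

end Families

/-- The class `C^{r+γ}_b`: `C^r` functions, bounded with bounded derivatives up to order `r`, and
`γ`-Hölder continuous derivative of order `r`. -/
def IsHolderClass {V W : Type*} [NormedAddCommGroup V] [NormedSpace ℝ V]
    [NormedAddCommGroup W] [NormedSpace ℝ W] (r : ℕ) (γ : ℝ) (f : V → W) : Prop :=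
  ContDiff ℝ r f ∧
  (∀ k ≤ r, ∃ K : ℝ, ∀ a, ‖iteratedFDeriv ℝ k f a‖ ≤ K) ∧
  ∃ K : ℝ, ∀ a b, ‖iteratedFDeriv ℝ r f a - iteratedFDeriv ℝ r f b‖ ≤ K * ‖a - b‖ ^ γ

section Rough

variable (U : Type*) [NormedAddCommGroup U] [NormedSpace ℝ U]

/-- The completed projective tensor square of `U`: the algebraic tensor square carries Mathlib's
projective norm. -/
abbrev TensorSquare : Type _ := UniformSpace.Completion (⨂[ℝ] _ : Fin 2, U)

variable {U}

/-- The elementary tensor `u ⊗ v`. -/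
def tmul (u v : U) : TensorSquare U :=
  ((⨂ₜ[ℝ] i, (![u, v] : Fin 2 → U) i : ⨂[ℝ] _ : Fin 2, U) : TensorSquare U)

/-- A rough path `(x⁽¹⁾, x⁽²⁾)` of finite `1/p`-Hölder norm controlled by `ω`, for `2 ≤ p < 3`:
the two levels satisfy Chen's relation and `‖x⁽ᵏ⁾_{s,t}‖ ≤ C ω_{s,t}^{k/p}`. -/
structure RoughPath (T p : ℝ) (ω : ℝ → ℝ → ℝ) (U : Type*) [NormedAddCommGroup U]
    [NormedSpace ℝ U] where
  fst : ℝ → ℝ → U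
  snd : ℝ → ℝ → TensorSquare U
  chen_fst : ∀ r s t, 0 ≤ r → r ≤ s → s ≤ t → t ≤ T → fst r t = fst r s + fst s t
  chen_snd : ∀ r s t, 0 ≤ r → r ≤ s → s ≤ t → t ≤ T →
    snd r t = snd r s + snd s t + tmul (fst r s) (fst s t)
  bound : ∃ C : ℝ, ∀ s t, 0 ≤ s → s ≤ t → t ≤ T →
    ‖fst s t‖ ≤ C * ω s t ^ (1 / p) ∧ ‖snd s t‖ ≤ C * ω s t ^ (2 / p)

variable {V : Type*} [NormedAddCommGroup V] [NormedSpace ℝ V] [CompleteSpace V]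

/-- The continuous linear map on the projective tensor square induced by a bounded bilinear
map. -/
def liftBilinear (B : U →L[ℝ] U →L[ℝ] V) : TensorSquare U →L[ℝ] V :=
  ContinuousLinearMap.extend
    (PiTensorProduct.liftIsometry ℝ (fun _ : Fin 2 => U) V
      (ContinuousLinearMap.uncurryLeft (Ei := fun _ : Fin 2 => U)
        ((continuousMultilinearCurryFin1 ℝ U V).symm.toContinuousLinearEquiv.toContinuousLinearMap
          ∘L B)))
    (UniformSpace.Completion.toComplL (𝕜 := ℝ) (E := ⨂[ℝ] _ : Fin 2, U))

theorem liftBilinear_tmul (B : U →L[ℝ] U →L[ℝ] V) (u v : U) :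
    liftBilinear B (tmul u v) = B u v := by
  have h := ContinuousLinearMap.extend_eq
    (f := PiTensorProduct.liftIsometry ℝ (fun _ : Fin 2 => U) V
      (ContinuousLinearMap.uncurryLeft (Ei := fun _ : Fin 2 => U)
        ((continuousMultilinearCurryFin1 ℝ U V).symm.toContinuousLinearEquiv.toContinuousLinearMap
          ∘L B)))
    (e := UniformSpace.Completion.toComplL (𝕜 := ℝ) (E := ⨂[ℝ] _ : Fin 2, U))
    UniformSpace.Completion.denseRange_coe
    (UniformSpace.Completion.isUniformInducing_coe _) (⨂ₜ[ℝ] i, (![u, v] : Fin 2 → U) i)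
  refine h.trans ?_
  simp

/-- The Davie expansion `φ_{t,s}(a) = a + f(a) x⁽¹⁾_{s,t} + (df(a) · f(a)) x⁽²⁾_{s,t}`, where
`df(a) · f(a)` is the bilinear map `(u, v) ↦ (df(a)(f(a) u)) v`. -/
def davie {T p : ℝ} {ω : ℝ → ℝ → ℝ} (f : V → U →L[ℝ] V) (x : RoughPath T p ω U)
    (t s : ℝ) (a : V) : V :=
  a + f a (x.fst s t) + liftBilinear ((fderiv ℝ f a) ∘L (f a)) (x.snd s t)

end Rough

end RoughFlow

end

/-! Write `θ = (2 + γ) / p`. The condition `p - 2 < γ` says exactly that `θ > 1`, so `ω ^ θ` is at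
most `ε ω` at small scales, and superadditivity sums errors of size `ε ω` along any subdivision.

The flow comes from a nonlinear sewing argument. Chen's relation cancels the low-order terms of
`φ_{t,s} ∘ φ_{s,r} - φ_{t,r}` and leaves a defect of order `ω ^ θ`, both in the supremum norm and in
the Lipschitz seminorm (`davie_defect`). Together with a four-point estimate (`davie_four_point`),
an induction that halves the control shows that products along arbitrary subdivisions stay within `L
ω ^ θ` of `φ` in both senses, with `L` independent of the subdivision (`IsSewable.subdiv_sub`).
Products along fine subdivisions are therefore uniformly Lipschitz and form a Cauchy net under
inclusion (`IsSewable.tendsto_sewn`). The limit composes exactly and, being a small Lipschitz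
perturbation of the identity over short intervals, is invertible
(`IsSewable.exists_sewn_bijective`).

Once a Lipschitz flow `ψ` at distance `O(ω ^ θ)` from `φ` exists, the convergence and uniqueness
claims are telescoping sums against it. For a family of maps this gives convergence of iterated
products (`iteratedConverges_of_near`); for a path it forces the path to be a trajectory of `ψ`
(`eq_flow_of_near`), whence uniqueness of the solution manifold and of the flow. -/

noncomputable section

namespace RoughFlow

/-! ### Controls near the diagonal. -/

section Control

variable {T : ℝ} {ω : ℝ → ℝ → ℝ}

theorem IsControl.mono (hω : IsControl T ω) {r s t q : ℝ} (hr : 0 ≤ r) (hrs : r ≤ s) (hst : s ≤ t)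
    (htq : t ≤ q) (hq : q ≤ T) : ω s t ≤ ω r q := by
  have h1 := hω.superadditive r s q hr hrs (hst.trans htq) hq
  have h2 := hω.superadditive s t q (hr.trans hrs) hst htq hq
  have h3 := hω.nonneg r s hr hrs (by linarith)
  have h4 := hω.nonneg t q (by linarith) htq hq
  linarith

/-- A control is uniformly small near the diagonal. -/
theorem IsControl.exists_small (hω : IsControl T ω) {ε : ℝ} (hε : 0 < ε) :
    ∃ ρ > 0, ∀ s t, 0 ≤ s → s ≤ t → t ≤ T → t - s ≤ ρ → ω s t ≤ ε := by
  have key : ∀ r : Set.Icc (0 : ℝ) T, ∃ d > 0, ∀ s t, 0 ≤ s → s ≤ t → t ≤ T →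
      |s - r| < d → |t - r| < d → ω s t ≤ ε := by
    rintro ⟨r, hr0, hrT⟩
    have h := hω.continuous_diag r hr0 hrT
    rw [Metric.continuousWithinAt_iff] at h
    obtain ⟨d, hd, h⟩ := h ε hε
    refine ⟨d, hd, fun s t hs hst ht h1 h2 => ?_⟩
    have := h (x := (s, t)) ⟨hs, hst, ht⟩ (by
      rw [Prod.dist_eq]; exact max_lt (by simpa [Real.dist_eq] using h1)
        (by simpa [Real.dist_eq] using h2))
    simp only [hω.diag r hr0 hrT, Real.dist_eq, sub_zero] at this
    exact (le_abs_self _).trans this.le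
  choose d hd hd' using key
  -- Continuity gives a radius depending on the diagonal point; compactness makes it uniform.
  obtain ⟨ρ, hρ, h⟩ := lebesgue_number_lemma_of_metric (isCompact_Icc (a := (0 : ℝ)) (b := T))
    (c := fun r : Set.Icc (0 : ℝ) T => Metric.ball (r : ℝ) (d r)) (fun _ => Metric.isOpen_ball)
    (fun r hr => Set.mem_iUnion.2 ⟨⟨r, hr⟩, Metric.mem_ball_self (hd _)⟩)
  refine ⟨ρ / 2, by positivity, fun s t hs hst ht hts => ?_⟩
  obtain ⟨r, hr⟩ := h s ⟨hs, hst.trans ht⟩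
  refine hd' r s t hs hst ht ?_ ?_
  · simpa [Real.dist_eq] using hr (Metric.mem_ball_self hρ)
  · have : t ∈ Metric.ball s ρ := by
      rw [Metric.mem_ball, Real.dist_eq, abs_of_nonneg (by linarith)]; linarith
    simpa [Real.dist_eq] using hr this

/-- The `θ`-th power of a control, `θ > 1`, is locally negligible with respect to the control. -/
theorem IsControl.exists_rpow_le (hω : IsControl T ω) {θ : ℝ} (hθ : 1 < θ) {ε : ℝ} (hε : 0 < ε) :
    ∃ ρ > 0, ∀ s t, 0 ≤ s → s ≤ t → t ≤ T → t - s ≤ ρ → ω s t ^ θ ≤ ε * ω s t := by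
  obtain ⟨ρ, hρ, h⟩ := hω.exists_small (ε := ε ^ (1 / (θ - 1))) (by positivity)
  refine ⟨ρ, hρ, fun s t hs hst ht hts => ?_⟩
  have h0 := hω.nonneg s t hs hst ht
  have h1 := h s t hs hst ht hts
  rcases h0.eq_or_lt with h0 | h0
  · rw [← h0, Real.zero_rpow (by linarith)]; simp
  · have : ω s t ^ θ = ω s t ^ (θ - 1) * ω s t := by
      conv_rhs => rw [← Real.rpow_one (ω s t), ← Real.rpow_mul h0.le, ← Real.rpow_add h0]
      congr 1; ring
    rw [this]
    gcongr
    calc ω s t ^ (θ - 1) ≤ (ε ^ (1 / (θ - 1))) ^ (θ - 1) :=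
          Real.rpow_le_rpow h0.le h1 (by linarith)
      _ = ε := by
        rw [← Real.rpow_mul hε.le, one_div_mul_cancel (by linarith), Real.rpow_one]

end Control

/-! ### Products along finite sets of times. -/

section Subdivision

variable {V : Type*} {φ : ℝ → ℝ → V → V} {S : Finset ℝ}

theorem chain_append (φ : ℝ → ℝ → V → V) (t r s : ℝ) (l₁ l₂ : List ℝ) :
    chain φ t s (l₁ ++ r :: l₂) = chain φ t r l₂ ∘ chain φ r s l₁ := by
  induction l₁ generalizing s with
  | nil => rfl
  | cons q l₁ ih => simp only [List.cons_append, chain, ih]; rfl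

/-- The composition of `φ` along the points of `S` strictly between `s` and `t`. -/
def subdiv (φ : ℝ → ℝ → V → V) (S : Finset ℝ) (t s : ℝ) : V → V :=
  chain φ t s ((S.filter fun r => s < r ∧ r < t).sort (· ≤ ·))

theorem subdiv_of_isEmpty {s t : ℝ} (h : ∀ r ∈ S, s < r → t ≤ r) : subdiv φ S t s = φ t s := by
  have : S.filter (fun r => s < r ∧ r < t) = ∅ := by
    refine Finset.filter_eq_empty_iff.2 fun r hr h' => ?_
    exact absurd (h r hr h'.1) (not_le.2 h'.2)
  simp [subdiv, this, chain]

theorem subdiv_comp_of_mem {r s t : ℝ} (hr : r ∈ S) (hsr : s < r) (hrt : r < t) :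
    subdiv φ S t s = subdiv φ S t r ∘ subdiv φ S r s := by
  rw [subdiv, subdiv, subdiv, ← chain_append]
  congr 1
  refine List.Perm.eq_of_pairwise (le := (· ≤ ·)) (fun a b _ _ => le_antisymm)
    (Finset.pairwise_sort _ _) ?_ ?_
  · rw [List.pairwise_append]
    refine ⟨Finset.pairwise_sort _ _, ?_, ?_⟩
    · rw [List.pairwise_cons]
      refine ⟨fun q hq => ?_, Finset.pairwise_sort _ _⟩
      simp only [Finset.mem_sort, Finset.mem_filter] at hq
      exact hq.2.1.le
    · intro a ha b hb
      simp only [Finset.mem_sort, Finset.mem_filter, List.mem_cons] at ha hb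
      rcases hb with rfl | hb
      · exact ha.2.2.le
      · exact (ha.2.2.trans hb.2.1).le
  · rw [List.perm_ext_iff_of_nodup (Finset.sort_nodup _ _)]
    · intro a
      simp only [Finset.mem_sort, Finset.mem_filter, List.mem_append, List.mem_cons]
      constructor
      · rintro ⟨h1, h2, h3⟩
        rcases lt_trichotomy a r with h | h | h
        · exact Or.inl ⟨h1, h2, h⟩
        · exact Or.inr (Or.inl h)
        · exact Or.inr (Or.inr ⟨h1, h, h3⟩)
      · rintro (⟨h1, h2, h3⟩ | rfl | ⟨h1, h2, h3⟩)
        · exact ⟨h1, h2, h3.trans hrt⟩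
        · exact ⟨hr, hsr, hrt⟩
        · exact ⟨h1, hsr.trans h2, h3⟩
    · rw [List.nodup_append]
      refine ⟨Finset.sort_nodup _ _, ?_, ?_⟩
      · rw [List.nodup_cons]
        exact ⟨by simp, Finset.sort_nodup _ _⟩
      · intro a ha b hb hab
        subst hab
        simp only [Finset.mem_sort, Finset.mem_filter, List.mem_cons] at ha hb
        rcases hb with rfl | hb
        · exact lt_irrefl _ ha.2.2
        · exact lt_asymm ha.2.2 hb.2.1

theorem subdiv_self (hφ : φ t t = id) : subdiv φ S t t = id := by
  rw [subdiv_of_isEmpty fun r _ h => h.le, hφ]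

theorem subdiv_comp {r s t : ℝ} (hs : φ s s = id) (ht : φ t t = id) (hsr : s ≤ r) (hrt : r ≤ t)
    (hr : r ∈ insert s (insert t S)) :
    subdiv φ S t s = subdiv φ S t r ∘ subdiv φ S r s := by
  rcases hsr.eq_or_lt with rfl | hsr
  · rw [subdiv_self hs]; rfl
  rcases hrt.eq_or_lt with rfl | hrt
  · rw [subdiv_self ht]; rfl
  refine subdiv_comp_of_mem ?_ hsr hrt
  simpa [hsr.ne', hrt.ne] using hr

/-- Between `s` and `t` there are two consecutive points such that the control before the first and
the control after the second are at most half of the total control. -/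
theorem IsControl.exists_consecutive {T : ℝ} {ω : ℝ → ℝ → ℝ} (hω : IsControl T ω) (S : Finset ℝ)
    {s t : ℝ} (hs : 0 ≤ s) (hst : s < t) (ht : t ≤ T) :
    ∃ u v, u ∈ insert s S ∧ v ∈ insert t S ∧ s ≤ u ∧ u < v ∧ v ≤ t ∧
      (∀ r ∈ S, u < r → v ≤ r) ∧ ω s u ≤ ω s t / 2 ∧ ω v t ≤ ω s t / 2 := by
  have hw := hω.nonneg s t hs hst.le ht
  -- `u` is the last point before `t` with at most half of the control behind it, and `v` is the
  -- next point. If `v < t`, then `v` has more than half behind it, so superadditivity leaves less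
  -- than half ahead.
  let A := (insert s S).filter fun r => s ≤ r ∧ r < t ∧ ω s r ≤ ω s t / 2
  have hA : s ∈ A := by
    simp only [A, Finset.mem_filter, Finset.mem_insert, true_or, true_and, le_refl]
    refine ⟨hst, ?_⟩
    rw [hω.diag s hs (by linarith)]; linarith
  obtain ⟨u, huA, hu⟩ := A.exists_max_image id ⟨s, hA⟩
  simp only [A, Finset.mem_filter, id] at huA hu
  obtain ⟨huS, hsu, hut, hωu⟩ := huA
  let B := (insert t S).filter fun r => u < r ∧ r ≤ t
  have hB : t ∈ B := by simp [B, hut]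
  obtain ⟨v, hvB, hv⟩ := B.exists_min_image id ⟨t, hB⟩
  simp only [B, Finset.mem_filter, id] at hvB hv
  obtain ⟨hvS, huv, hvt⟩ := hvB
  refine ⟨u, v, huS, hvS, hsu, huv, hvt, fun r hr hur => ?_, hωu, ?_⟩
  · by_cases hrt : r ≤ t
    · exact hv r ⟨Finset.mem_insert_of_mem hr, hur, hrt⟩
    · linarith
  · rcases hvt.eq_or_lt with rfl | hvt
    · rw [hω.diag v (by linarith) ht]; linarith
    · have hvS' : v ∈ S := (Finset.mem_insert.1 hvS).resolve_left hvt.ne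
      by_contra! hcon
      have h1 := hω.superadditive s v t hs (by linarith) hvt.le ht
      have := hu v ⟨Finset.mem_insert_of_mem hvS', by linarith, hvt, by linarith⟩
      linarith

end Subdivision

/-! ### Nonlinear sewing: estimates uniform in the subdivision. -/

section Sewing

variable {V : Type*} [NormedAddCommGroup V]

/-- Quantitative assumptions on a family of maps under which its iterated products satisfy uniform
Lipschitz estimates: on intervals whose control is at most `κ`, the maps `φ_{t,s} - id` are
`d`-Lipschitz, satisfy a four-point estimate, and the defect `φ_{t,s} ∘ φ_{s,r} - φ_{t,r}` is
bounded and Lipschitz with constants of order `ω_{r,t} ^ θ`. -/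
structure IsSewable (T : ℝ) (ω : ℝ → ℝ → ℝ) (θ κ d L M B : ℝ) (φ : ℝ → ℝ → V → V) : Prop where
  one_lt : 1 < θ
  κ_pos : 0 < κ
  d_nonneg : 0 ≤ d
  d_le : d ≤ 1 / 4
  L_nonneg : 0 ≤ L
  M_nonneg : 0 ≤ M
  L_mul_le : L * κ ^ θ ≤ d
  balance : L * (1 / 2) ^ θ * (2 * (1 + d) ^ 2) + (3 * M + 2) ≤ L
  refl : ∀ t, 0 ≤ t → t ≤ T → φ t t = id
  near : ∀ s t, 0 ≤ s → s ≤ t → t ≤ T → ∀ a, ‖φ t s a - a‖ ≤ B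
  lip : ∀ s t, 0 ≤ s → s ≤ t → t ≤ T → ω s t ≤ κ → ∀ a b,
    ‖(φ t s a - a) - (φ t s b - b)‖ ≤ d * ‖a - b‖
  four : ∀ s t, 0 ≤ s → s ≤ t → t ≤ T → ∀ w, ω s t ≤ w → w ≤ κ → ∀ a b a' b',
    ‖a - a'‖ ≤ L * w ^ θ → ‖b - b'‖ ≤ L * w ^ θ →
    ‖(φ t s a - φ t s b) - (φ t s a' - φ t s b')‖ ≤
      (1 + d) * ‖(a - b) - (a' - b')‖ + w ^ θ * ‖a' - b'‖
  defect : ∀ r s t, 0 ≤ r → r ≤ s → s ≤ t → t ≤ T → ω r t ≤ κ → ∀ a,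
    ‖φ t s (φ s r a) - φ t r a‖ ≤ M * ω r t ^ θ
  defect_lip : ∀ r s t, 0 ≤ r → r ≤ s → s ≤ t → t ≤ T → ω r t ≤ κ → ∀ a b,
    ‖(φ t s (φ s r a) - φ t r a) - (φ t s (φ s r b) - φ t r b)‖ ≤ M * ω r t ^ θ * ‖a - b‖

variable {T : ℝ} {ω : ℝ → ℝ → ℝ} {θ κ d L M B : ℝ} {φ : ℝ → ℝ → V → V}

theorem IsSewable.lipschitz (h : IsSewable T ω θ κ d L M B φ) {s t : ℝ} (hs : 0 ≤ s) (hst : s ≤ t)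
    (ht : t ≤ T) (hκ : ω s t ≤ κ) (a b : V) :
    ‖φ t s a - φ t s b‖ ≤ (1 + d) * ‖a - b‖ := by
  have h1 := h.lip s t hs hst ht hκ a b
  calc ‖φ t s a - φ t s b‖ = ‖((φ t s a - a) - (φ t s b - b)) + (a - b)‖ := by congr 1; abel
    _ ≤ d * ‖a - b‖ + ‖a - b‖ := norm_add_le_of_le h1 le_rfl
    _ = _ := by ring

/-- Maps close to a nearly Lipschitz map in the Lipschitz seminorm are Lipschitz. -/
theorem lipschitz_of_sub {A A' : V → V} {c k : ℝ} (h : ∀ a b, ‖A' a - A' b‖ ≤ c * ‖a - b‖)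
    (h' : ∀ a b, ‖(A a - A' a) - (A b - A' b)‖ ≤ k * ‖a - b‖) (a b : V) :
    ‖A a - A b‖ ≤ (c + k) * ‖a - b‖ := by
  calc ‖A a - A b‖ = ‖(A' a - A' b) + ((A a - A' a) - (A b - A' b))‖ := by congr 1; abel
    _ ≤ c * ‖a - b‖ + k * ‖a - b‖ := norm_add_le_of_le (h a b) (h' a b)
    _ = _ := by ring

/-- Iterated products stay close to `φ`, in the supremum norm and in the Lipschitz seminorm. -/
theorem IsSewable.subdiv_sub (h : IsSewable T ω θ κ d L M B φ) (hω : IsControl T ω) (S : Finset ℝ)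
    {s t : ℝ} (hs : 0 ≤ s) (hst : s ≤ t) (ht : t ≤ T) (hκ : ω s t ≤ κ) :
    (∀ a, ‖subdiv φ S t s a - φ t s a‖ ≤ L * ω s t ^ θ) ∧
    ∀ a b, ‖(subdiv φ S t s a - φ t s a) - (subdiv φ S t s b - φ t s b)‖ ≤
      L * ω s t ^ θ * ‖a - b‖ := by
  obtain ⟨n, hn⟩ : ∃ n, (S.filter fun r => s < r ∧ r < t).card = n := ⟨_, rfl⟩
  induction n using Nat.strong_induction_on generalizing s t with
  | _ n ih =>
  have hw := hω.nonneg s t hs hst ht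
  have hθ0 : 0 ≤ θ := by linarith [h.one_lt]
  have hW : 0 ≤ ω s t ^ θ := Real.rpow_nonneg hw _
  have hL := h.L_nonneg
  have hM := h.M_nonneg
  by_cases hS : ∀ r ∈ S, s < r → t ≤ r
  · rw [subdiv_of_isEmpty hS]
    refine ⟨fun a => ?_, fun a b => ?_⟩
    · simp only [sub_self, norm_zero]; positivity
    · simp only [sub_self, norm_zero]; positivity
  push Not at hS
  obtain ⟨q, hqS, hsq, hqt⟩ := hS
  obtain ⟨u, v, huS, hvS, hsu, huv, hvt, hcons, hωu, hωv⟩ :=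
    hω.exists_consecutive S hs (hsq.trans hqt) ht
  have hs' := h.refl s hs (hst.trans ht)
  have ht' := h.refl t (hs.trans hst) ht
  have hu' := h.refl u (hs.trans hsu) (by linarith)
  have hsplit : subdiv φ S t s = subdiv φ S t v ∘ φ v u ∘ subdiv φ S u s := by
    have hu_mem : u ∈ insert s (insert t S) := by
      rcases Finset.mem_insert.1 huS with rfl | h
      · simp
      · simp [h]
    rw [subdiv_comp hs' ht' hsu (huv.le.trans hvt) hu_mem, subdiv_comp hu' ht' huv.le hvt,
      subdiv_of_isEmpty (φ := φ) hcons]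
    · rfl
    · exact Finset.mem_insert_of_mem hvS
  have hcardu : (S.filter fun r => s < r ∧ r < u).card < n := by
    rw [← hn]
    refine Finset.card_lt_card ⟨fun r hr => ?_, fun hsub => ?_⟩
    · simp only [Finset.mem_filter] at hr ⊢
      exact ⟨hr.1, hr.2.1, by linarith⟩
    · rcases Finset.mem_insert.1 huS with rfl | huS
      · have := hsub (Finset.mem_filter.2 ⟨hqS, hsq, hqt⟩)
        simp only [Finset.mem_filter] at this
        linarith
      · rcases hsu.eq_or_lt with rfl | hsu
        · have := hsub (Finset.mem_filter.2 ⟨hqS, hsq, hqt⟩)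
          simp only [Finset.mem_filter] at this
          linarith
        · have := hsub (Finset.mem_filter.2 ⟨huS, hsu, by linarith⟩)
          simp at this
  have hcardv : (S.filter fun r => v < r ∧ r < t).card < n := by
    rw [← hn]
    refine Finset.card_lt_card ⟨fun r hr => ?_, fun hsub => ?_⟩
    · simp only [Finset.mem_filter] at hr ⊢
      exact ⟨hr.1, by linarith, hr.2.2⟩
    · rcases hvt.eq_or_lt with rfl | hvt
      · have := hsub (Finset.mem_filter.2 ⟨hqS, hsq, hqt⟩)
        simp only [Finset.mem_filter] at this
        linarith
      · have hvS := (Finset.mem_insert.1 hvS).resolve_left hvt.ne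
        have := hsub (Finset.mem_filter.2 ⟨hvS, by linarith, hvt⟩)
        simp at this
  have hsu_w : ω s u ≤ ω s t := hω.mono hs le_rfl hsu (by linarith) ht
  have hut_w : ω u t ≤ ω s t := hω.mono hs hsu (by linarith) le_rfl ht
  have hvt_w : ω v t ≤ ω s t := hω.mono hs (by linarith) hvt le_rfl ht
  have huv_w : ω u v ≤ ω s t := hω.mono hs hsu huv.le hvt ht
  have half : ∀ x, 0 ≤ x → x ≤ ω s t / 2 → L * x ^ θ ≤ L * (1 / 2) ^ θ * ω s t ^ θ := by
    intro x hx hx'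
    rw [mul_assoc, ← Real.mul_rpow (by norm_num) hw]
    gcongr
    linarith
  obtain ⟨hB1, hB2⟩ := ih _ hcardu hs hsu (by linarith) (by linarith) rfl
  obtain ⟨hA1, hA2⟩ := ih _ hcardv (by linarith) hvt ht (by linarith) rfl
  have hB1' : ∀ a, ‖subdiv φ S u s a - φ u s a‖ ≤ L * (1 / 2) ^ θ * ω s t ^ θ := fun a =>
    (hB1 a).trans (half _ (hω.nonneg _ _ hs hsu (by linarith)) hωu)
  have hA1' : ∀ a, ‖subdiv φ S t v a - φ t v a‖ ≤ L * (1 / 2) ^ θ * ω s t ^ θ := fun a =>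
    (hA1 a).trans (half _ (hω.nonneg _ _ (by linarith) hvt ht) hωv)
  have hB2' : ∀ a b, ‖(subdiv φ S u s a - φ u s a) - (subdiv φ S u s b - φ u s b)‖ ≤
      L * (1 / 2) ^ θ * ω s t ^ θ * ‖a - b‖ := fun a b => (hB2 a b).trans
    (mul_le_mul_of_nonneg_right (half _ (hω.nonneg _ _ hs hsu (by linarith)) hωu) (norm_nonneg _))
  have hA2' : ∀ a b, ‖(subdiv φ S t v a - φ t v a) - (subdiv φ S t v b - φ t v b)‖ ≤
      L * (1 / 2) ^ θ * ω s t ^ θ * ‖a - b‖ := fun a b => (hA2 a b).trans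
    (mul_le_mul_of_nonneg_right (half _ (hω.nonneg _ _ (by linarith) hvt ht) hωv) (norm_nonneg _))
  have hhalf1 : (1 / 2 : ℝ) ^ θ ≤ 1 := Real.rpow_le_one (by norm_num) (by norm_num) hθ0
  have hLW : L * ω s t ^ θ ≤ d := le_trans (by gcongr) h.L_mul_le
  have hLhW : L * (1 / 2) ^ θ * ω s t ^ θ ≤ L * ω s t ^ θ := by
    have : L * (1 / 2) ^ θ ≤ L * 1 := by gcongr
    rw [mul_one] at this
    gcongr
  have hd := h.d_nonneg
  have hd4 := h.d_le
  have hB0 : ∀ a b, ‖φ u s a - φ u s b‖ ≤ (1 + d) * ‖a - b‖ :=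
    h.lipschitz hs hsu (by linarith) (by linarith)
  have hBl : ∀ a b, ‖subdiv φ S u s a - subdiv φ S u s b‖ ≤ (1 + 2 * d) * ‖a - b‖ := fun a b =>
    (lipschitz_of_sub hB0 hB2' a b).trans (mul_le_mul_of_nonneg_right (by linarith) (norm_nonneg _))
  have hC : ∀ a b, ‖φ v u a - φ v u b‖ ≤ (1 + d) * ‖a - b‖ :=
    h.lipschitz (by linarith) huv.le (by linarith) (by linarith)
  have hφut : ∀ a b, ‖φ t u a - φ t u b‖ ≤ (1 + d) * ‖a - b‖ :=
    h.lipschitz (by linarith) (by linarith) ht (by linarith)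
  have hD1 : ∀ a, ‖φ t v (φ v u a) - φ t u a‖ ≤ M * ω s t ^ θ := fun a =>
    (h.defect u v t (by linarith) huv.le hvt ht (by linarith) a).trans
      (mul_le_mul_of_nonneg_left (Real.rpow_le_rpow
        (hω.nonneg u t (by linarith) (by linarith) ht) hut_w hθ0) hM)
  have hD1' : ∀ a b, ‖(φ t v (φ v u a) - φ t u a) - (φ t v (φ v u b) - φ t u b)‖ ≤
      M * ω s t ^ θ * ‖a - b‖ := fun a b =>
    (h.defect_lip u v t (by linarith) huv.le hvt ht (by linarith) a b).trans
      (mul_le_mul_of_nonneg_right (mul_le_mul_of_nonneg_left (Real.rpow_le_rpow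
        (hω.nonneg u t (by linarith) (by linarith) ht) hut_w hθ0) hM) (norm_nonneg _))
  have hD2 := h.defect s u t hs hsu (by linarith) ht hκ
  have hD2' := h.defect_lip s u t hs hsu (by linarith) ht hκ
  have hbal := h.balance
  set W := ω s t ^ θ
  set k := (1 / 2 : ℝ) ^ θ
  have hk : 0 ≤ k := by positivity
  rw [hsplit]
  simp only [Function.comp_apply]
  set A := subdiv φ S t v
  set Bs := subdiv φ S u s
  -- The outer products `A` and `Bs` carry half of the control each, so the induction hypothesis
  -- gives them the factor `k = (1/2) ^ θ`; the two remaining differences are defects of `φ`.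
  have hdecomp : ∀ a, A (φ v u (Bs a)) - φ t s a =
      (A (φ v u (Bs a)) - φ t v (φ v u (Bs a))) + (φ t v (φ v u (Bs a)) - φ t u (Bs a)) +
      (φ t u (Bs a) - φ t u (φ u s a)) + (φ t u (φ u s a) - φ t s a) := fun a => by abel
  refine ⟨fun a => ?_, fun a b => ?_⟩
  · rw [hdecomp]
    have h3 : ‖φ t u (Bs a) - φ t u (φ u s a)‖ ≤ (1 + d) * (L * k * W) :=
      (hφut _ _).trans (mul_le_mul_of_nonneg_left (hB1' a) (by linarith))
    refine (norm_add_le_of_le (norm_add_le_of_le (norm_add_le_of_le (hA1' _) (hD1 _)) h3)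
      (hD2 a)).trans ?_
    have : (L * k * (2 * (1 + d) ^ 2) + (3 * M + 2)) * W ≤ L * W := by gcongr
    refine le_trans ?_ this
    have h5 : 0 ≤ L * k * W := by positivity
    have h6 : 0 ≤ M * W := by positivity
    nlinarith [mul_nonneg h5 hd, mul_nonneg h5 (sq_nonneg d)]
  · rw [hdecomp a, hdecomp b, add_sub_add_comm, add_sub_add_comm, add_sub_add_comm]
    have h1 : ‖(A (φ v u (Bs a)) - φ t v (φ v u (Bs a))) -
        (A (φ v u (Bs b)) - φ t v (φ v u (Bs b)))‖ ≤
        L * k * W * ((1 + d) * ((1 + 2 * d) * ‖a - b‖)) :=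
      (hA2' _ _).trans (mul_le_mul_of_nonneg_left ((hC _ _).trans
        (mul_le_mul_of_nonneg_left (hBl a b) (by linarith))) (by positivity))
    have h2 := (hD1' (Bs a) (Bs b)).trans
      (mul_le_mul_of_nonneg_left (hBl a b) (by positivity : 0 ≤ M * W))
    have h3 : ‖(φ t u (Bs a) - φ t u (φ u s a)) - (φ t u (Bs b) - φ t u (φ u s b))‖ ≤
        (1 + d) * (L * k * W * ‖a - b‖) + W * ((1 + d) * ‖a - b‖) := by
      -- The interval is `[u,t]`, but the distance from `Bs` to `φ u s` is only controlled through
      -- `ω s t`. This is why the four-point hypothesis has a free upper bound `w`.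
      have := h.four u t (by linarith) (by linarith) ht _ hut_w hκ (Bs a) (Bs b) (φ u s a)
        (φ u s b) ((hB1' a).trans hLhW) ((hB1' b).trans hLhW)
      rw [sub_sub_sub_comm, sub_sub_sub_comm (Bs a)] at this
      refine this.trans (add_le_add ?_ ?_)
      · exact mul_le_mul_of_nonneg_left (hB2' a b) (by linarith)
      · exact mul_le_mul_of_nonneg_left (hB0 a b) hW
    refine (norm_add_le_of_le (norm_add_le_of_le (norm_add_le_of_le h1 h2) h3)
      (hD2' a b)).trans ?_
    -- The coefficient of `L k` is `(1 + d)(1 + 2d) + (1 + d) = 2(1 + d)^2`, that of `M` is `2 + 2d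
    -- ≤ 3`, and the four-point term adds `1 + d ≤ 2`: this is the source of the `balance`
    -- condition.
    have : (L * k * (2 * (1 + d) ^ 2) + (3 * M + 2)) * (W * ‖a - b‖) ≤ L * (W * ‖a - b‖) := by
      gcongr
    rw [mul_assoc L W]
    refine le_trans ?_ this
    have h5 : 0 ≤ W * ‖a - b‖ := by positivity
    have h6 : 0 ≤ M * (W * ‖a - b‖) := by positivity
    nlinarith [mul_nonneg h5 hd, mul_nonneg h6 hd, mul_le_mul_of_nonneg_left hd4 h5,
      mul_le_mul_of_nonneg_left hd4 h6]

end Sewing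

/-! ### Convergence of the products under refinement. -/

section Limit

variable {V : Type*} [NormedAddCommGroup V]
variable {T : ℝ} {ω : ℝ → ℝ → ℝ} {θ κ d L M B : ℝ} {φ : ℝ → ℝ → V → V}

/-- Every interval in `[0,T]` of length more than `ρ` has a point of `S` in its interior. -/
def IsFine (T ρ : ℝ) (S : Finset ℝ) : Prop :=
  ∀ s t, 0 ≤ s → t ≤ T → ρ < t - s → ∃ r ∈ S, s < r ∧ r < t

theorem exists_isFine (T : ℝ) {ρ : ℝ} (hρ : 0 < ρ) : ∃ S, IsFine T ρ S := by
  refine ⟨(Finset.range (⌈T / ρ⌉₊ + 1)).image fun k : ℕ => k * ρ, fun s t hs ht hst => ?_⟩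
  -- The first multiple of `ρ` strictly above `s` is at most `s + ρ < t`.
  have h1 : s < ((⌊s / ρ⌋₊ + 1 : ℕ) : ℝ) * ρ := by
    rw [← div_lt_iff₀ hρ]; push_cast; exact Nat.lt_floor_add_one _
  have h2 : ((⌊s / ρ⌋₊ + 1 : ℕ) : ℝ) * ρ < t := by
    have := Nat.floor_le (show 0 ≤ s / ρ by positivity)
    rw [le_div_iff₀ hρ] at this
    push_cast; linarith
  refine ⟨_, Finset.mem_image_of_mem _ (Finset.mem_range.2 (Nat.lt_succ_of_le ?_)), h1, h2⟩
  have : ((⌊s / ρ⌋₊ + 1 : ℕ) : ℝ) ≤ T / ρ := by rw [le_div_iff₀ hρ]; linarith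
  exact_mod_cast this.trans (Nat.le_ceil _)

theorem IsFine.mono {ρ : ℝ} {R S : Finset ℝ} (hR : IsFine T ρ R) (h : R ⊆ S) : IsFine T ρ S :=
  fun s t hs ht hst => let ⟨r, hr, h'⟩ := hR s t hs ht hst; ⟨r, h hr, h'⟩

theorem IsSewable.L_mul_rpow_le (h : IsSewable T ω θ κ d L M B φ) {w : ℝ} (hw : 0 ≤ w)
    (hκ : w ≤ κ) : L * w ^ θ ≤ d :=
  le_trans (mul_le_mul_of_nonneg_left (Real.rpow_le_rpow hw hκ (by linarith [h.one_lt]))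
    h.L_nonneg) h.L_mul_le

/-- Iterated products along fine subdivisions are uniformly Lipschitz. -/
theorem IsSewable.exists_subdiv_lipschitz (h : IsSewable T ω θ κ d L M B φ) (hω : IsControl T ω) :
    ∃ K ≥ 0, ∃ ρ > 0, ∀ S, IsFine T ρ S → ∀ s t, 0 ≤ s → s ≤ t → t ≤ T → ∀ a b,
      ‖subdiv φ S t s a - subdiv φ S t s b‖ ≤ K * ‖a - b‖ := by
  obtain ⟨ρ, hρ, hsmall⟩ := hω.exists_small h.κ_pos
  -- Products split only at points of `S`. Fineness `ρ / 4` provides one between `s + ρ / 2` and `s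
  -- + ρ`, so each cut advances by at least `ρ / 2` and costs a factor `1 + 2d ≤ 2`.
  have key : ∀ S, IsFine T (ρ / 4) S → ∀ n : ℕ, ∀ s t, 0 ≤ s → s ≤ t → t ≤ T →
      t - s ≤ (n + 1) * (ρ / 2) → ∀ a b,
      ‖subdiv φ S t s a - subdiv φ S t s b‖ ≤ 2 ^ (n + 1) * ‖a - b‖ := by
    intro S hS n
    have short : ∀ s t, 0 ≤ s → s ≤ t → t ≤ T → t - s ≤ ρ → ∀ a b,
        ‖subdiv φ S t s a - subdiv φ S t s b‖ ≤ 2 * ‖a - b‖ := by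
      intro s t hs hst ht hts a b
      have hκ := hsmall s t hs hst ht hts
      refine (lipschitz_of_sub (h.lipschitz hs hst ht hκ) (h.subdiv_sub hω S hs hst ht hκ).2
        a b).trans (mul_le_mul_of_nonneg_right ?_ (norm_nonneg _))
      have := h.L_mul_rpow_le (hω.nonneg s t hs hst ht) hκ
      linarith [h.d_le]
    induction n with
    | zero =>
      intro s t hs hst ht hts a b
      refine (short s t hs hst ht ?_ a b).trans (by norm_num)
      norm_num at hts; linarith
    | succ n ih =>
      intro s t hs hst ht hts a b
      by_cases hρt : t - s ≤ ρ
      · refine (short s t hs hst ht hρt a b).trans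
          (mul_le_mul_of_nonneg_right ?_ (norm_nonneg _))
        calc (2 : ℝ) = 2 ^ 1 := by norm_num
          _ ≤ 2 ^ (n + 1 + 1) := pow_le_pow_right₀ (by norm_num) (by omega)
      · push Not at hρt
        obtain ⟨r, hrS, hr1, hr2⟩ := hS (s + ρ / 2) (s + ρ) (by linarith) (by linarith)
          (by linarith)
        rw [subdiv_comp_of_mem hrS (by linarith) (by linarith)]
        simp only [Function.comp_apply]
        refine (ih r t (by linarith) (by linarith) ht (by push_cast at hts; linarith) _ _).trans ?_
        rw [pow_succ 2 (n + 1), mul_assoc]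
        exact mul_le_mul_of_nonneg_left
          (short s r hs (by linarith) (by linarith) (by linarith) a b) (by positivity)
  refine ⟨2 ^ (⌈T / (ρ / 2)⌉₊ + 1), by positivity, ρ / 4, by positivity,
    fun S hS s t hs hst ht => key S hS _ s t hs hst ht ?_⟩
  have := Nat.le_ceil (T / (ρ / 2))
  rw [div_le_iff₀ (by positivity)] at this
  nlinarith

/-- Comparison of iterated products along a fine subdivision with those along a finer one. -/
theorem norm_subdiv_sub_subdiv_le (hω : IsControl T ω) {R S : Finset ℝ} (hRS : R ⊆ S)
    {ρ K k : ℝ} (hR : IsFine T ρ R) (hK : 1 ≤ K) (hk : 0 ≤ k)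
    (hlip : ∀ s t, 0 ≤ s → s ≤ t → t ≤ T → ∀ a b,
      ‖subdiv φ S t s a - subdiv φ S t s b‖ ≤ K * ‖a - b‖)
    (hnear : ∀ s t, 0 ≤ s → s ≤ t → t ≤ T → t - s ≤ ρ → ∀ a,
      ‖φ t s a - subdiv φ S t s a‖ ≤ k * ω s t)
    {s t : ℝ} (hs : 0 ≤ s) (hst : s ≤ t) (ht : t ≤ T) (a : V) :
    ‖subdiv φ R t s a - subdiv φ S t s a‖ ≤ K * k * ω s t := by
  obtain ⟨n, hn⟩ : ∃ n, (R.filter fun r => s < r ∧ r < t).card = n := ⟨_, rfl⟩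
  induction n using Nat.strong_induction_on generalizing s a with
  | _ n ih =>
  have hw := hω.nonneg s t hs hst ht
  by_cases hS : ∀ r ∈ R, s < r → t ≤ r
  · rw [subdiv_of_isEmpty hS]
    have hts : t - s ≤ ρ := by
      by_contra! hcon
      obtain ⟨r, hr, h1, h2⟩ := hR s t hs ht hcon
      linarith [hS r hr h1]
    refine (hnear s t hs hst ht hts a).trans ?_
    have : 0 ≤ k * ω s t := by positivity
    nlinarith
  push Not at hS
  obtain ⟨q, hqS, hsq, hqt⟩ := hS
  obtain ⟨r, hr, hmin⟩ := (R.filter fun r => s < r ∧ r < t).exists_min_image id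
    ⟨q, Finset.mem_filter.2 ⟨hqS, hsq, hqt⟩⟩
  simp only [Finset.mem_filter, id] at hr hmin
  obtain ⟨hrR, hsr, hrt⟩ := hr
  have hempty : ∀ q ∈ R, s < q → r ≤ q := fun q hq hsq => by
    by_contra! hcon
    linarith [hmin q ⟨hq, hsq, by linarith⟩]
  have hrs : r - s ≤ ρ := by
    by_contra! hcon
    obtain ⟨q, hq, h1, h2⟩ := hR s r hs (by linarith) hcon
    linarith [hempty q hq h1]
  rw [subdiv_comp_of_mem hrR hsr hrt, subdiv_comp_of_mem (hRS hrR) hsr hrt,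
    subdiv_of_isEmpty hempty]
  simp only [Function.comp_apply]
  have hcard : (R.filter fun q => r < q ∧ q < t).card < n := by
    rw [← hn]
    refine Finset.card_lt_card ⟨fun q hq => ?_, fun hsub => ?_⟩
    · simp only [Finset.mem_filter] at hq ⊢
      exact ⟨hq.1, by linarith, hq.2.2⟩
    · have := hsub (Finset.mem_filter.2 ⟨hrR, hsr, hrt⟩)
      simp at this
  -- Both products split at `r`, the first point of `R` after `s`. The one-step error on `[s,r]` is
  -- transported by the `K`-Lipschitz product along `S`, and superadditivity adds the contributions.
  have h1 := ih _ hcard (by linarith) hrt.le (φ r s a) rfl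
  have h2 := (hlip r t (by linarith) hrt.le ht (φ r s a) (subdiv φ S r s a)).trans
    (mul_le_mul_of_nonneg_left (hnear s r hs hsr.le (by linarith) hrs a) (by linarith))
  have h3 := hω.superadditive s r t hs hsr.le hrt.le ht
  refine (norm_sub_le_norm_sub_add_norm_sub _ (subdiv φ S t r (φ r s a)) _).trans
    ((add_le_add h1 h2).trans ?_)
  have : K * k * (ω s r + ω r t) ≤ K * k * ω s t :=
    mul_le_mul_of_nonneg_left h3 (by positivity)
  linarith

open Filter Topology

/-- The limit of the iterated products of `φ` along finite sets ordered by inclusion. -/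
def sewn (φ : ℝ → ℝ → V → V) (t s : ℝ) (a : V) : V :=
  limUnder atTop fun S : Finset ℝ => subdiv φ S t s a

theorem eventually_isFine (T : ℝ) {ρ : ℝ} (hρ : 0 < ρ) :
    ∀ᶠ S : Finset ℝ in atTop, IsFine T ρ S := by
  obtain ⟨S₀, hS₀⟩ := exists_isFine T hρ
  filter_upwards [eventually_ge_atTop S₀] with S hS using hS₀.mono hS

theorem sewn_self {t : ℝ} (h : φ t t = id) : sewn φ t t = id := by
  funext a
  simp only [sewn, subdiv_self h, id]
  exact tendsto_const_nhds.limUnder_eq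

variable [CompleteSpace V]

/-- Refining a fine set replaces each of its steps by a product that differs by at most `L ω ^ θ`, a
small multiple of `ω`; the total change is then a small multiple of `ω s t`, which is the Cauchy
property. -/
theorem IsSewable.tendsto_sewn (h : IsSewable T ω θ κ d L M B φ) (hω : IsControl T ω) {s t : ℝ}
    (hs : 0 ≤ s) (hst : s ≤ t) (ht : t ≤ T) (a : V) :
    Tendsto (fun S : Finset ℝ => subdiv φ S t s a) atTop (𝓝 (sewn φ t s a)) := by
  refine CauchySeq.tendsto_limUnder (Metric.cauchySeq_iff'.2 fun ε hε => ?_)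
  obtain ⟨K, hK, ρ₁, hρ₁, hlip⟩ := h.exists_subdiv_lipschitz hω
  obtain ⟨ρ₂, hρ₂, hsmall⟩ := hω.exists_small h.κ_pos
  have hw := hω.nonneg s t hs hst ht
  have hL := h.L_nonneg
  -- Normalisation: the final error is `(ε / (2 * c)) * (c - 1) < ε`.
  set c := (K + 1) * L * ω s t + 1
  have hc : 0 < c := by positivity
  obtain ⟨ρ₃, hρ₃, hpow⟩ := hω.exists_rpow_le h.one_lt (ε := ε / (2 * c)) (by positivity)
  obtain ⟨R, hR⟩ := exists_isFine T (ρ := min ρ₁ (min ρ₂ ρ₃)) (by positivity)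
  refine ⟨R, fun S hS => ?_⟩
  rw [dist_comm, dist_eq_norm]
  have hfine : IsFine T ρ₁ S := fun s t hs ht hst => hR.mono hS s t hs ht
    ((min_le_left _ _).trans_lt hst)
  have := norm_subdiv_sub_subdiv_le (K := K + 1) (k := L * (ε / (2 * c))) hω hS hR (by linarith)
    (by positivity)
    (fun s t hs hst ht a b => (hlip S hfine s t hs hst ht a b).trans (by gcongr; linarith))
    (fun s t hs hst ht hts a => by
      rw [norm_sub_rev]
      refine ((h.subdiv_sub hω S hs hst ht (hsmall s t hs hst ht (hts.trans
        ((min_le_right _ _).trans (min_le_left _ _))))).1 a).trans ?_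
      rw [mul_assoc]
      exact mul_le_mul_of_nonneg_left (hpow s t hs hst ht (hts.trans
        ((min_le_right _ _).trans (min_le_right _ _)))) hL) hs hst ht a
  refine this.trans_lt ?_
  have h1 : (K + 1) * (L * (ε / (2 * c))) * ω s t = (ε / (2 * c)) * (c - 1) := by
    simp only [c]; ring
  rw [h1, div_mul_eq_mul_div, div_lt_iff₀ (by positivity)]
  nlinarith

theorem IsSewable.sewn_lipschitz (h : IsSewable T ω θ κ d L M B φ) (hω : IsControl T ω) :
    ∃ K ≥ 0, ∀ s t, 0 ≤ s → s ≤ t → t ≤ T → ∀ a b,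
      ‖sewn φ t s a - sewn φ t s b‖ ≤ K * ‖a - b‖ := by
  obtain ⟨K, hK, ρ, hρ, hlip⟩ := h.exists_subdiv_lipschitz hω
  refine ⟨K, hK, fun s t hs hst ht a b => ?_⟩
  refine le_of_tendsto ((h.tendsto_sewn hω hs hst ht a).sub (h.tendsto_sewn hω hs hst ht b)).norm ?_
  filter_upwards [eventually_isFine T hρ] with S hS using hlip S hS s t hs hst ht a b

theorem IsSewable.norm_sewn_sub_le (h : IsSewable T ω θ κ d L M B φ) (hω : IsControl T ω)
    {s t : ℝ} (hs : 0 ≤ s) (hst : s ≤ t) (ht : t ≤ T) (hκ : ω s t ≤ κ) (a : V) :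
    ‖sewn φ t s a - φ t s a‖ ≤ L * ω s t ^ θ :=
  le_of_tendsto ((h.tendsto_sewn hω hs hst ht a).sub_const _).norm
    (Eventually.of_forall fun S => (h.subdiv_sub hω S hs hst ht hκ).1 a)

theorem IsSewable.norm_sewn_sub_sub_le (h : IsSewable T ω θ κ d L M B φ) (hω : IsControl T ω)
    {s t : ℝ} (hs : 0 ≤ s) (hst : s ≤ t) (ht : t ≤ T) (hκ : ω s t ≤ κ) (a b : V) :
    ‖(sewn φ t s a - φ t s a) - (sewn φ t s b - φ t s b)‖ ≤ L * ω s t ^ θ * ‖a - b‖ :=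
  le_of_tendsto (((h.tendsto_sewn hω hs hst ht a).sub_const _).sub
    ((h.tendsto_sewn hω hs hst ht b).sub_const _)).norm
    (Eventually.of_forall fun S => (h.subdiv_sub hω S hs hst ht hκ).2 a b)

/-- Ordering subdivisions by inclusion makes `s` eventually a subdivision point. From then on the
products compose exactly, and their uniform Lipschitz bound lets the inner product be replaced by
its limit. -/
theorem IsSewable.sewn_comp (h : IsSewable T ω θ κ d L M B φ) (hω : IsControl T ω) {r s t : ℝ}
    (hr : 0 ≤ r) (hrs : r ≤ s) (hst : s ≤ t) (ht : t ≤ T) (a : V) :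
    sewn φ t s (sewn φ s r a) = sewn φ t r a := by
  obtain ⟨K, hK, ρ, hρ, hlip⟩ := h.exists_subdiv_lipschitz hω
  have h1 := h.tendsto_sewn hω hr hrs (hst.trans ht) a
  have h2 := h.tendsto_sewn hω (hr.trans hrs) hst ht (sewn φ s r a)
  have h3 := h.tendsto_sewn hω hr (hrs.trans hst) ht a
  refine tendsto_nhds_unique ?_ h3
  have h4 : Tendsto (fun S : Finset ℝ => subdiv φ S t r a - subdiv φ S t s (sewn φ s r a)) atTop
      (𝓝 0) := by
    refine squeeze_zero_norm' (a := fun S : Finset ℝ => K * ‖subdiv φ S s r a - sewn φ s r a‖) ?_ ?_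
    · filter_upwards [eventually_isFine T hρ, eventually_ge_atTop {s}] with S hS hsS
      rw [subdiv_comp (h.refl r hr (by linarith)) (h.refl t (by linarith) ht) hrs hst
        (by simp [Finset.singleton_subset_iff.1 hsS])]
      exact hlip S hS s t (by linarith) hst ht _ _
    · simpa using ((h1.sub_const (sewn φ s r a)).norm).const_mul K
  simpa using h4.add h2

end Limit

/-! ### Invertibility and the two-sided flow. -/

section Flow

variable {V : Type*} [NormedAddCommGroup V]
variable {T : ℝ} {ω : ℝ → ℝ → ℝ} {θ κ d L M B : ℝ} {φ : ℝ → ℝ → V → V}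

/-- The extension of a one-sided flow `ψ_{t,s}`, `s ≤ t`, by the inverse maps for `t < s`. -/
def twoSided (ψ : ℝ → ℝ → V → V) (t s : ℝ) : V → V :=
  if s ≤ t then ψ t s else Function.invFun (ψ s t)

theorem twoSided_of_le {ψ : ℝ → ℝ → V → V} {s t : ℝ} (h : s ≤ t) : twoSided ψ t s = ψ t s :=
  if_pos h

theorem isFlow_twoSided {ψ : ℝ → ℝ → V → V} (hrefl : ∀ t, 0 ≤ t → t ≤ T → ψ t t = id)
    (hcomp : ∀ r s t, 0 ≤ r → r ≤ s → s ≤ t → t ≤ T → ∀ a, ψ t s (ψ s r a) = ψ t r a)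
    (hbij : ∀ s t, 0 ≤ s → s ≤ t → t ≤ T → Function.Bijective (ψ t s)) :
    IsFlow T (twoSided ψ) := by
  have hinv : ∀ s t, 0 ≤ s → s ≤ t → t ≤ T → ∀ a,
      twoSided ψ s t (twoSided ψ t s a) = a ∧ twoSided ψ t s (twoSided ψ s t a) = a := by
    intro s t hs hst ht a
    rcases hst.eq_or_lt with rfl | hlt
    · simp [twoSided_of_le le_rfl, hrefl s hs ht]
    · rw [twoSided_of_le hst, twoSided, if_neg (not_le.2 hlt)]
      exact ⟨Function.leftInverse_invFun (hbij s t hs hst ht).1 a,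
        Function.rightInverse_invFun (hbij s t hs hst ht).2 a⟩
  refine ⟨fun t ht => ?_, fun r hr s hs t ht hrst => ?_, fun s hs t ht => ?_⟩
  · rw [twoSided_of_le le_rfl, hrefl t ht.1 ht.2]
  · funext a
    rcases hrst with ⟨h1, h2⟩ | ⟨h1, h2⟩
    · rw [Function.comp_apply, twoSided_of_le h1, twoSided_of_le h2, twoSided_of_le (h1.trans h2),
        hcomp r s t hr.1 h1 h2 ht.2]
    -- For decreasing times, applying the injective forward map `ψ r t` to both sides reduces the
    -- identity to forward composition.
    · have hb := (hbij t r ht.1 (h1.trans h2) hr.2).1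
      apply hb
      rw [← hcomp t s r ht.1 h1 h2 hr.2, ← twoSided_of_le (ψ := ψ) h1, Function.comp_apply,
        (hinv t s ht.1 h1 hs.2 _).2, ← twoSided_of_le (ψ := ψ) h2, (hinv s r hs.1 h2 hr.2 a).2,
        ← twoSided_of_le (ψ := ψ) (h1.trans h2),
        (hinv t r ht.1 (h1.trans h2) hr.2 a).2]
  · rcases le_total s t with h | h
    · exact ⟨fun a => (hinv s t hs.1 h ht.2 a).1, fun a => (hinv s t hs.1 h ht.2 a).2⟩
    · exact ⟨fun a => (hinv t s ht.1 h hs.2 a).2, fun a => (hinv t s ht.1 h hs.2 a).1⟩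

variable [CompleteSpace V]

/-- A map at Lipschitz distance at most `1/2` from the identity is invertible. -/
theorem bijective_of_sub_id {A : V → V}
    (hA : ∀ a b, ‖(A a - a) - (A b - b)‖ ≤ 1 / 2 * ‖a - b‖) :
    Function.Bijective A ∧ ∀ a b, ‖a - b‖ ≤ 2 * ‖A a - A b‖ := by
  have hanti : ∀ a b, ‖a - b‖ ≤ 2 * ‖A a - A b‖ := by
    intro a b
    have : ‖a - b‖ ≤ ‖A a - A b‖ + ‖(A a - a) - (A b - b)‖ := by
      calc ‖a - b‖ = ‖(A a - A b) - ((A a - a) - (A b - b))‖ := by congr 1; abel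
        _ ≤ _ := norm_sub_le _ _
    linarith [hA a b]
  refine ⟨⟨fun a b hab => ?_, fun y => ?_⟩, hanti⟩
  · have := hanti a b
    rw [hab, sub_self, norm_zero, mul_zero] at this
    exact sub_eq_zero.1 (norm_le_zero_iff.1 this)
  -- A solution of `A x = y` is a fixed point of `x ↦ y - (A x - x)`.
  · have hc : ContractingWith (1 / 2 : ℝ≥0) fun x => y - (A x - x) := by
      refine ⟨by norm_num, LipschitzWith.of_dist_le_mul fun a b => ?_⟩
      rw [dist_eq_norm, dist_eq_norm, sub_sub_sub_cancel_left, norm_sub_rev]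
      exact (hA a b).trans (by simp)
    have := hc.fixedPoint_isFixedPt
    refine ⟨ContractingWith.fixedPoint _ hc, ?_⟩
    have h : y - (A (ContractingWith.fixedPoint _ hc) - ContractingWith.fixedPoint _ hc) =
      ContractingWith.fixedPoint _ hc := this
    rw [sub_sub_eq_add_sub, sub_eq_iff_eq_add, add_comm] at h
    exact (add_left_cancel h).symm

/-- Over a short interval, `sewn φ t s - id` has Lipschitz constant at most `L ω ^ θ + d ≤ 2d ≤
1/2`. A longer interval is a composition of boundedly many short ones, each doubling the Lipschitz
bound of the inverse and adding `B + d` to the displacement. -/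
theorem IsSewable.exists_sewn_bijective (h : IsSewable T ω θ κ d L M B φ) (hω : IsControl T ω) :
    ∃ K ≥ 0, ∀ s t, 0 ≤ s → s ≤ t → t ≤ T → Function.Bijective (sewn φ t s) ∧
      (∀ a b, ‖a - b‖ ≤ K * ‖sewn φ t s a - sewn φ t s b‖) ∧
      ∀ a, ‖sewn φ t s a - a‖ ≤ K * (B + d) := by
  obtain ⟨ρ, hρ, hsmall⟩ := hω.exists_small h.κ_pos
  have key : ∀ n : ℕ, ∀ s t, 0 ≤ s → s ≤ t → t ≤ T → t - s ≤ (n + 1) * ρ →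
      Function.Bijective (sewn φ t s) ∧
      (∀ a b, ‖a - b‖ ≤ 2 ^ (n + 1) * ‖sewn φ t s a - sewn φ t s b‖) ∧
      ∀ a, ‖sewn φ t s a - a‖ ≤ (n + 1) * (B + d) := by
    have short : ∀ s t, 0 ≤ s → s ≤ t → t ≤ T → t - s ≤ ρ →
        Function.Bijective (sewn φ t s) ∧
        (∀ a b, ‖a - b‖ ≤ 2 * ‖sewn φ t s a - sewn φ t s b‖) ∧
        ∀ a, ‖sewn φ t s a - a‖ ≤ B + d := by
      intro s t hs hst ht hts
      have hκ := hsmall s t hs hst ht hts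
      have hLd := h.L_mul_rpow_le (hω.nonneg s t hs hst ht) hκ
      rw [← and_assoc]
      refine ⟨bijective_of_sub_id fun a b => ?_, fun a => ?_⟩
      · calc ‖(sewn φ t s a - a) - (sewn φ t s b - b)‖
            = ‖((sewn φ t s a - φ t s a) - (sewn φ t s b - φ t s b)) +
                ((φ t s a - a) - (φ t s b - b))‖ := by congr 1; abel
          _ ≤ L * ω s t ^ θ * ‖a - b‖ + d * ‖a - b‖ := norm_add_le_of_le
              (h.norm_sewn_sub_sub_le hω hs hst ht hκ a b) (h.lip s t hs hst ht hκ a b)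
          _ = (L * ω s t ^ θ + d) * ‖a - b‖ := by ring
          _ ≤ _ := mul_le_mul_of_nonneg_right (by linarith [h.d_le]) (norm_nonneg _)
      · have h1 := h.norm_sewn_sub_le hω hs hst ht hκ a
        have h2 := h.near s t hs hst ht a
        have h3 := norm_sub_le_norm_sub_add_norm_sub (sewn φ t s a) (φ t s a) a
        linarith
    intro n
    induction n with
    | zero =>
      intro s t hs hst ht hts
      simpa using short s t hs hst ht (by simpa using hts)
    | succ n ih =>
      intro s t hs hst ht hts
      have hr1 : s ≤ max s (t - ρ) := le_max_left _ _
      have hr2 : max s (t - ρ) ≤ t := max_le hst (by linarith)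
      set r := max s (t - ρ)
      have hr3 : t - r ≤ ρ := by linarith [le_max_right s (t - ρ)]
      have hr4 : r - s ≤ (n + 1) * ρ := by
        rw [sub_le_iff_le_add]
        exact max_le (by have : 0 ≤ ((n : ℝ) + 1) * ρ := by positivity
                         linarith) (by push_cast at hts; linarith)
      obtain ⟨a1, a2, a3⟩ := ih s r hs hr1 (hr2.trans ht) hr4
      obtain ⟨b1, b2, b3⟩ := short r t (hs.trans hr1) hr2 ht hr3
      have hcomp : sewn φ t s = sewn φ t r ∘ sewn φ r s :=
        funext fun a => (h.sewn_comp hω hs hr1 hr2 ht a).symm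
      rw [hcomp]
      refine ⟨b1.comp a1, fun a b => ?_, fun a => ?_⟩
      · refine (a2 a b).trans ?_
        rw [pow_succ _ (n + 1), mul_assoc]
        exact mul_le_mul_of_nonneg_left (b2 _ _) (by positivity)
      · have h1 := a3 a
        have h2 := b3 (sewn φ r s a)
        have h3 := norm_sub_le_norm_sub_add_norm_sub (sewn φ t r (sewn φ r s a)) (sewn φ r s a) a
        simp only [Function.comp_apply]
        push_cast
        linarith
  have hN := Nat.le_ceil (T / ρ)
  rw [div_le_iff₀ hρ] at hN
  refine ⟨2 ^ (⌈T / ρ⌉₊ + 1), by positivity, fun s t hs hst ht => ?_⟩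
  obtain ⟨h1, h2, h3⟩ := key ⌈T / ρ⌉₊ s t hs hst ht (by linarith)
  refine ⟨h1, h2, fun a => (h3 a).trans (mul_le_mul_of_nonneg_right ?_ ?_)⟩
  -- The constant `2 ^ (n + 1)` also dominates the number `n + 1` of pieces, so one `K` serves both
  -- estimates.
  · exact_mod_cast (Nat.lt_two_pow_self (n := ⌈T / ρ⌉₊ + 1)).le
  · have := (norm_nonneg _).trans (h.near s t hs hst ht a)
    linarith [h.d_nonneg]

/-- The sewing estimate is local. Where `ω > κ`, both maps have bounded displacement while `ω ^ θ ≥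
κ ^ θ`, so a larger constant makes it global. -/
theorem IsSewable.exists_norm_sewn_sub_le (h : IsSewable T ω θ κ d L M B φ)
    (hω : IsControl T ω) :
    ∃ C, ∀ s t, 0 ≤ s → s ≤ t → t ≤ T → ∀ a, ‖φ t s a - sewn φ t s a‖ ≤ C * ω s t ^ θ := by
  obtain ⟨K, hK, hsewn⟩ := h.exists_sewn_bijective hω
  have hκ0 : 0 < κ ^ θ := Real.rpow_pos_of_pos h.κ_pos _
  refine ⟨max L ((B + K * (B + d)) / κ ^ θ), fun s t hs hst ht a => ?_⟩
  have hw := hω.nonneg s t hs hst ht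
  by_cases hκ : ω s t ≤ κ
  · rw [norm_sub_rev]
    exact (h.norm_sewn_sub_le hω hs hst ht hκ a).trans
      (mul_le_mul_of_nonneg_right (le_max_left _ _) (by positivity))
  · push Not at hκ
    have h1 := h.near s t hs hst ht a
    have h2 := (hsewn s t hs hst ht).2.2 a
    have h0 := (norm_nonneg _).trans h1
    have hd := h.d_nonneg
    rw [norm_sub_rev] at h2
    refine (norm_sub_le_norm_sub_add_norm_sub _ a _).trans ((add_le_add h1 h2).trans ?_)
    calc B + K * (B + d) = (B + K * (B + d)) / κ ^ θ * κ ^ θ := by field_simp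
      _ ≤ max L ((B + K * (B + d)) / κ ^ θ) * ω s t ^ θ := by
        gcongr
        · exact le_max_right _ _
        · exact h.κ_pos.le
        · linarith [h.one_lt]

/-- A sewable family has a Lipschitz flow in its galaxy. -/
theorem IsSewable.exists_flow (h : IsSewable T ω θ κ d L M B φ) (hω : IsControl T ω) :
    ∃ ψ : ℝ → ℝ → V → V, IsFlow T ψ ∧ IsLipschitzFamily T ψ ∧
      ∃ C, ∀ s t, 0 ≤ s → s ≤ t → t ≤ T → ∀ a, ‖φ t s a - ψ t s a‖ ≤ C * ω s t ^ θ := by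
  obtain ⟨K, hK, hlip⟩ := h.sewn_lipschitz hω
  obtain ⟨K', hK', hbij⟩ := h.exists_sewn_bijective hω
  obtain ⟨C, hC⟩ := h.exists_norm_sewn_sub_le hω
  have hflow : IsFlow T (twoSided (sewn φ)) := isFlow_twoSided
    (fun t h0 hT => sewn_self (h.refl t h0 hT))
    (fun r s t hr hrs hst ht a => h.sewn_comp hω hr hrs hst ht a)
    (fun s t hs hst ht => (hbij s t hs hst ht).1)
  refine ⟨twoSided (sewn φ), hflow, ⟨(max K K').toNNReal, fun s hs t ht => ?_⟩, C,
    fun s t hs hst ht a => by rw [twoSided_of_le hst]; exact hC s t hs hst ht a⟩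
  refine LipschitzWith.of_dist_le_mul fun a b => ?_
  rw [dist_eq_norm, dist_eq_norm, Real.coe_toNNReal _ (le_max_of_le_left hK)]
  rcases le_total s t with hst | hst
  · rw [twoSided_of_le hst]
    exact (hlip s t hs.1 hst ht.2 a b).trans
      (mul_le_mul_of_nonneg_right (le_max_left _ _) (norm_nonneg _))
  · have := (hbij t s ht.1 hst hs.2).2.1 (twoSided (sewn φ) t s a) (twoSided (sewn φ) t s b)
    rw [← twoSided_of_le (ψ := sewn φ) hst] at this
    rw [(hflow.inv s hs t ht).1 a, (hflow.inv s hs t ht).1 b] at this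
    exact this.trans (mul_le_mul_of_nonneg_right (le_max_right _ _) (norm_nonneg _))

end Flow

/-! ### Telescoping against a Lipschitz flow. -/

section Convergence

variable {V : Type*} [NormedAddCommGroup V]
variable {T : ℝ} {ω : ℝ → ℝ → ℝ} {θ : ℝ} {ψ χ : ℝ → ℝ → V → V}

/-- Telescoping estimate for the product of `χ` along a list of small steps, when `χ` is close to
a Lipschitz flow `ψ` on small intervals. -/
theorem norm_chain_filter_sub_le (hω : IsControl T ω) {K k ρ : ℝ} (hK : 1 ≤ K) (hk : 0 ≤ k)
    (hρ : 0 ≤ ρ)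
    (hcomp : ∀ r s t, 0 ≤ r → r ≤ s → s ≤ t → t ≤ T → ∀ a, ψ t s (ψ s r a) = ψ t r a)
    (hlip : ∀ s t, 0 ≤ s → s ≤ t → t ≤ T → ∀ a b, ‖ψ t s a - ψ t s b‖ ≤ K * ‖a - b‖)
    (hnear : ∀ s t, 0 ≤ s → s ≤ t → t ≤ T → t - s ≤ ρ → ∀ a,
      ‖χ t s a - ψ t s a‖ ≤ k * ω s t) (l : List ℝ) {x s t : ℝ} (hs : 0 ≤ s) (hst : s ≤ t)
    (ht : t ≤ T) (hx : x ≤ s) (hmono : (x :: l).Pairwise (· ≤ ·))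
    (hstep : (x :: l).IsChain fun a b => b - a ≤ ρ) (hlast : ∃ y ∈ x :: l, t ≤ y) (a : V) :
    ‖chain χ t s (l.filter fun r => s ≤ r ∧ r ≤ t) a - ψ t s a‖ ≤ K * k * ω s t := by
  have hone : ∀ s, 0 ≤ s → s ≤ t → t - s ≤ ρ → ∀ a,
      ‖χ t s a - ψ t s a‖ ≤ K * k * ω s t := fun s hs hst hts a => by
    refine (hnear s t hs hst ht hts a).trans ?_
    have : 0 ≤ k * ω s t := mul_nonneg hk (hω.nonneg s t hs hst ht)
    nlinarith
  -- The head `x ≤ s` is the last partition point already passed; it guarantees that the next point,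
  -- or `t` if that comes first, is within `ρ` of `s`.
  induction l generalizing x s a with
  | nil =>
    obtain ⟨y, hy, hty⟩ := hlast
    obtain rfl : y = x := by simpa using hy
    obtain rfl : s = t := by linarith
    obtain rfl : y = s := by linarith
    simp only [List.filter_nil, chain]
    exact hone y hs le_rfl (by simpa using hρ) a
  | cons y l ih =>
    rw [List.isChain_cons_cons] at hstep
    obtain ⟨hxy, hstep⟩ := hstep
    rw [List.pairwise_cons] at hmono
    obtain ⟨hmono1, hmono⟩ := hmono
    have hxy' : x ≤ y := hmono1 y (by simp)
    have hyl := (List.pairwise_cons.1 hmono).1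
    obtain ⟨z, hz, htz⟩ := hlast
    rcases lt_or_ge y s with hys | hys
    · rw [List.filter_cons_of_neg (by simp [hys])]
      refine ih hs hst hys.le hmono hstep ⟨z, ?_, htz⟩ a
      rcases List.mem_cons.1 hz with rfl | hz
      · linarith
      · exact hz
    rcases lt_or_ge t y with hty | hty
    · have : List.filter (fun r => decide (s ≤ r ∧ r ≤ t)) (y :: l) = [] := by
        rw [List.filter_eq_nil_iff]
        intro r hr
        rcases List.mem_cons.1 hr with rfl | hr
        · simp [hty]
        · simp [hty.trans_le (hyl r hr)]
      rw [this]
      exact hone s hs hst (by linarith) a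
    · rw [List.filter_cons_of_pos (by simp [hys, hty])]
      have hfilter : List.filter (fun r => decide (s ≤ r ∧ r ≤ t)) l =
          List.filter (fun r => decide (y ≤ r ∧ r ≤ t)) l := by
        refine List.filter_congr fun r hr => ?_
        simp [hyl r hr, hys.trans (hyl r hr)]
      rw [hfilter]
      simp only [chain, Function.comp_apply]
      have h1 := ih (a := χ y s a) (hs.trans hys) hty le_rfl hmono hstep (by
        rcases List.mem_cons.1 hz with rfl | hz
        · exact ⟨y, by simp, by linarith⟩
        · exact ⟨z, hz, htz⟩)
      have h2 := (hlip y t (hs.trans hys) hty ht (χ y s a) (ψ y s a)).trans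
        (mul_le_mul_of_nonneg_left (hnear s y hs hys (hty.trans ht) (by linarith) a)
          (by linarith))
      rw [hcomp s y t hs hys hty ht] at h2
      have h3 := hω.superadditive s y t hs hys hty ht
      refine (norm_sub_le_norm_sub_add_norm_sub _ (ψ t y (χ y s a)) _).trans
        ((add_le_add h1 h2).trans ?_)
      have : K * k * (ω s y + ω y t) ≤ K * k * ω s t :=
        mul_le_mul_of_nonneg_left h3 (by positivity)
      linarith

theorem Partition.step_le_mesh {T : ℝ} (π : Partition T) (i : Fin π.n) :
    π.pt i.succ - π.pt i.castSucc ≤ π.mesh :=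
  le_ciSup (f := fun i : Fin π.n => π.pt i.succ - π.pt i.castSucc)
    (Set.finite_range _).bddAbove i

/-- Turns an `O(ω ^ θ)` error into `ε ω`, the form that superadditivity can sum. The constant `|C| +
1` is positive whatever the sign of `C`. -/
theorem norm_sub_le_const_mul_of_rpow (hω : IsControl T ω) (hθ : 1 < θ) {C ε : ℝ} (hε : 0 < ε) :
    ∃ ρ > 0, ∀ s t, 0 ≤ s → s ≤ t → t ≤ T → t - s ≤ ρ → ∀ x : V, ‖x‖ ≤ C * ω s t ^ θ →
      ‖x‖ ≤ ε * ω s t := by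
  obtain ⟨ρ, hρ, h⟩ := hω.exists_rpow_le hθ (ε := ε / (|C| + 1)) (by positivity)
  refine ⟨ρ, hρ, fun s t hs hst ht hts x hx => hx.trans ?_⟩
  have h0 := hω.nonneg s t hs hst ht
  calc C * ω s t ^ θ ≤ (|C| + 1) * ω s t ^ θ :=
        mul_le_mul_of_nonneg_right (by linarith [le_abs_self C]) (by positivity)
    _ ≤ (|C| + 1) * (ε / (|C| + 1) * ω s t) :=
        mul_le_mul_of_nonneg_left (h s t hs hst ht hts) (by positivity)
    _ = ε * ω s t := by field_simp

/-- The iterated products of any family in the galaxy of a Lipschitz flow converge to it. -/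
theorem iteratedConverges_of_near (hω : IsControl T ω) (hθ : 1 < θ) (hT : 0 ≤ T)
    (hψ : IsFlow T ψ) (hψL : IsLipschitzFamily T ψ) {C : ℝ}
    (hC : ∀ s t, 0 ≤ s → s ≤ t → t ≤ T → ∀ a, ‖χ t s a - ψ t s a‖ ≤ C * ω s t ^ θ) :
    IteratedConverges T χ ψ := by
  obtain ⟨K, hK⟩ := hψL
  intro ε hε
  have hωT := hω.nonneg 0 T le_rfl hT le_rfl
  obtain ⟨ρ, hρ, h⟩ := norm_sub_le_const_mul_of_rpow (V := V) hω hθ (C := C)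
    (ε := ε / ((K + 1) * (ω 0 T + 1))) (by positivity)
  refine ⟨ρ, hρ, fun π hπ s t hs hst ht a => ?_⟩
  have hpw : (List.ofFn π.pt).Pairwise (· ≤ ·) := π.mono.sortedLE_ofFn.pairwise
  have hch : (List.ofFn π.pt).IsChain fun a b => b - a ≤ ρ := by
    rw [List.isChain_ofFn]
    exact fun i hi => (π.step_le_mesh ⟨i, by omega⟩).trans hπ
  have hT_mem : T ∈ List.ofFn π.pt := List.mem_ofFn.2 ⟨_, π.last⟩
  -- The head `x = 0` duplicates the first partition point, with a step of length zero. `K + 1`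
  -- replaces `K` because the telescoping needs a constant at least `1`.
  have hmain := norm_chain_filter_sub_le (χ := χ) (ψ := ψ) (K := K + 1)
    (k := ε / ((K + 1) * (ω 0 T + 1))) hω (by simp) (by positivity) hρ.le
    (fun r s t hr hrs hst ht a => congrFun (hψ.comp r ⟨hr, by linarith⟩ s ⟨by linarith, by linarith⟩
      t ⟨by linarith, ht⟩ (Or.inl ⟨hrs, hst⟩)) a)
    (fun s t hs hst ht a b => by
      have := (hK s ⟨hs, by linarith⟩ t ⟨by linarith, ht⟩).dist_le_mul a b
      rw [dist_eq_norm, dist_eq_norm] at this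
      refine this.trans (mul_le_mul_of_nonneg_right (by simp) (norm_nonneg _)))
    (fun s t hs hst ht hts a => h s t hs hst ht hts _ (hC s t hs hst ht a))
    (List.ofFn π.pt) (x := 0) hs hst ht hs
    (by
      rw [List.pairwise_cons]
      refine ⟨fun y hy => ?_, hpw⟩
      obtain ⟨i, rfl⟩ := List.mem_ofFn.1 hy
      exact π.first.symm.le.trans (π.mono (Fin.zero_le _)))
    (by
      rw [List.ofFn_succ] at hch ⊢
      rw [List.isChain_cons_cons]
      exact ⟨by rw [π.first, sub_zero]; exact hρ.le, hch⟩)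
    ⟨T, List.mem_cons_of_mem _ hT_mem, ht⟩ a
  refine hmain.trans ?_
  have h1 : ω s t ≤ ω 0 T := hω.mono le_rfl hs hst ht le_rfl
  have h0 := hω.nonneg s t hs hst ht
  calc (K + 1) * (ε / ((K + 1) * (ω 0 T + 1))) * ω s t = ε * (ω s t / (ω 0 T + 1)) := by
        field_simp
    _ ≤ ε * 1 := by
        gcongr
        rw [div_le_one (by positivity)]; linarith
    _ = ε := mul_one _

/-- A path that is locally close to the trajectories of a Lipschitz flow is a trajectory. -/
theorem eq_flow_of_near (hω : IsControl T ω) (hθ : 1 < θ) (hψ : IsFlow T ψ)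
    (hψL : IsLipschitzFamily T ψ) {r : ℝ} (hr : 0 ≤ r) {y : ℝ → V} {C : ℝ}
    (hC : ∀ s t, r ≤ s → s ≤ t → t ≤ T → ‖y t - ψ t s (y s)‖ ≤ C * ω s t ^ θ)
    {t : ℝ} (hrt : r ≤ t) (ht : t ≤ T) : y t = ψ t r (y r) := by
  obtain ⟨K, hK⟩ := hψL
  rw [← sub_eq_zero, ← norm_le_zero_iff]
  have hωt := hω.nonneg r t hr hrt ht
  refine le_of_forall_pos_le_add fun ε hε => ?_
  rw [zero_add]
  obtain ⟨ρ, hρ, h⟩ := norm_sub_le_const_mul_of_rpow (V := V) hω hθ (C := C)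
    (ε := ε / ((K + 1) * (ω r t + 1))) (by positivity)
  set k := ε / ((K + 1) * (ω r t + 1))
  have hk : 0 ≤ k := by positivity
  -- Telescoping backwards from `t` in steps of length at most `ρ`; each local error is transported
  -- to `t` by the flow.
  have key : ∀ n : ℕ, ∀ s, r ≤ s → s ≤ t → t - s ≤ n * ρ →
      ‖y t - ψ t s (y s)‖ ≤ (K + 1) * k * ω s t := by
    intro n
    induction n with
    | zero =>
      intro s hrs hst hts
      obtain rfl : s = t := by norm_num at hts; linarith
      rw [hψ.refl s ⟨by linarith, ht⟩, hω.diag s (by linarith) ht]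
      simp
    | succ n ih =>
      intro s hrs hst hts
      have hq1 : s ≤ min t (s + ρ) := le_min hst (by linarith)
      have hq2 : min t (s + ρ) ≤ t := min_le_left _ _
      have hq3 : min t (s + ρ) - s ≤ ρ := by linarith [min_le_right t (s + ρ)]
      have hq4 : t - min t (s + ρ) ≤ n * ρ := by
        rw [sub_le_comm]
        refine le_min ?_ ?_
        · have : 0 ≤ n * ρ := by positivity
          linarith
        · push_cast at hts; linarith
      set q := min t (s + ρ)
      have h1 := ih q (hrs.trans hq1) hq2 hq4
      have h2 := h s q (hr.trans hrs) hq1 (hq2.trans ht) hq3 _ (hC s q hrs hq1 (hq2.trans ht))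
      have h3 := (hK q ⟨by linarith, by linarith⟩ t ⟨by linarith, ht⟩).dist_le_mul (y q)
        (ψ q s (y s))
      rw [dist_eq_norm, dist_eq_norm] at h3
      have h4 : ψ t q (ψ q s (y s)) = ψ t s (y s) := congrFun (hψ.comp s ⟨by linarith, by linarith⟩
        q ⟨by linarith, by linarith⟩ t ⟨by linarith, ht⟩ (Or.inl ⟨hq1, hq2⟩)) (y s)
      rw [h4] at h3
      have h5 := hω.superadditive s q t (hr.trans hrs) hq1 hq2 ht
      have h6 : (K : ℝ) * ‖y q - ψ q s (y s)‖ ≤ (K + 1) * (k * ω s q) :=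
        mul_le_mul (by simp) h2 (norm_nonneg _) (by positivity)
      refine (norm_sub_le_norm_sub_add_norm_sub _ (ψ t q (y q)) _).trans
        ((add_le_add h1 (h3.trans h6)).trans ?_)
      have : (K + 1) * k * (ω s q + ω q t) ≤ (K + 1) * k * ω s t :=
        mul_le_mul_of_nonneg_left h5 (by positivity)
      linarith
  have hN := Nat.le_ceil ((t - r) / ρ)
  rw [div_le_iff₀ hρ] at hN
  refine (key _ r le_rfl hrt hN).trans ?_
  calc (K + 1) * k * ω r t = ε * (ω r t / (ω r t + 1)) := by
        simp only [k]; field_simp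
    _ ≤ ε * 1 := by
        gcongr
        rw [div_le_one (by positivity)]; linarith
    _ = ε := mul_one _

open Filter Topology

theorem eventually_mul_rpow_le {c q ε : ℝ} (hq : 0 < q) (hε : 0 < ε) :
    ∀ᶠ u in 𝓝[>] (0 : ℝ), c * u ^ q ≤ ε := by
  have h : Tendsto (fun u : ℝ => c * u ^ q) (𝓝 0) (𝓝 0) := by
    have := ((continuous_id.tendsto (0 : ℝ)).rpow_const (p := q) (Or.inr hq.le)).const_mul c
    simpa [Real.zero_rpow hq.ne'] using this
  filter_upwards [(h.mono_left nhdsWithin_le_nhds).eventually_lt_const hε] with u hu using hu.le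

/-- The trajectories of a flow close to a family of perturbations of the identity are continuous. -/
theorem continuousOn_flow {θ : ℝ} {φ ψ : ℝ → ℝ → V → V} (hω : IsControl T ω) {q C N : ℝ}
    (hq : 0 < q) (hθ : 0 < θ) (hψ : IsFlow T ψ)
    (hφ : ∀ s t, 0 ≤ s → s ≤ t → t ≤ T → ∀ a, ‖φ t s a - a‖ ≤ N * ω s t ^ q)
    (hC : ∀ s t, 0 ≤ s → s ≤ t → t ≤ T → ∀ a, ‖φ t s a - ψ t s a‖ ≤ C * ω s t ^ θ)
    {r : ℝ} (hr : 0 ≤ r) (a : V) : ContinuousOn (fun t => ψ t r a) (Set.Icc r T) := by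
  have key : ∀ ε > 0, ∃ ρ > 0, ∀ s t, r ≤ s → s ≤ t → t ≤ T → t - s ≤ ρ →
      ‖ψ t r a - ψ s r a‖ < ε := by
    intro ε hε
    obtain ⟨κ, ⟨h1, h2⟩, hκ : 0 < κ⟩ :=
      (((eventually_mul_rpow_le (c := |N|) hq (by positivity : 0 < ε / 3)).and
      (eventually_mul_rpow_le (c := |C|) hθ (by positivity : 0 < ε / 3))).and
        self_mem_nhdsWithin).exists
    obtain ⟨ρ, hρ, hsmall⟩ := hω.exists_small hκ
    refine ⟨ρ, hρ, fun s t hrs hst ht hts => ?_⟩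
    have hs : 0 ≤ s := hr.trans hrs
    have h0 := hω.nonneg s t hs hst ht
    have hκ' := hsmall s t hs hst ht hts
    have e : ψ t r a = ψ t s (ψ s r a) := (congrFun (hψ.comp r ⟨hr, by linarith⟩ s
      ⟨hs, by linarith⟩ t ⟨by linarith, ht⟩ (Or.inl ⟨hrs, hst⟩)) a).symm
    rw [e]
    have h3 := hφ s t hs hst ht (ψ s r a)
    have h4 := hC s t hs hst ht (ψ s r a)
    have bd : ∀ {k q : ℝ}, 0 < q → k * ω s t ^ q ≤ |k| * κ ^ q := fun hq =>
      mul_le_mul (le_abs_self _) (Real.rpow_le_rpow h0 hκ' hq.le) (by positivity) (abs_nonneg _)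
    rw [norm_sub_rev] at h4
    have h5 := norm_sub_le_norm_sub_add_norm_sub (ψ t s (ψ s r a)) (φ t s (ψ s r a)) (ψ s r a)
    linarith [bd (k := N) hq, bd (k := C) hθ]
  refine Metric.continuousOn_iff.2 fun t ht ε hε => ?_
  obtain ⟨ρ, hρ, h⟩ := key ε hε
  refine ⟨ρ, hρ, fun s hs hst => ?_⟩
  rw [Real.dist_eq] at hst
  rw [dist_eq_norm]
  rcases le_total s t with hle | hle
  · rw [norm_sub_rev]
    exact h s t hs.1 hle ht.2 (by linarith [neg_abs_le (s - t)])
  · exact h t s ht.1 hle hs.2 ((le_abs_self _).trans hst.le)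

end Convergence

/-! ### Four-point and Taylor estimates for Hölder classes. -/

section Calculus

variable {V W : Type*} [NormedAddCommGroup V] [NormedSpace ℝ V] [NormedAddCommGroup W]
  [NormedSpace ℝ W]

theorem norm_iteratedFDeriv_succ_sub (n : ℕ) (f : V → W) (a b : V) :
    ‖iteratedFDeriv ℝ (n + 1) f a - iteratedFDeriv ℝ (n + 1) f b‖ =
      ‖iteratedFDeriv ℝ n (fderiv ℝ f) a - iteratedFDeriv ℝ n (fderiv ℝ f) b‖ := by
  rw [iteratedFDeriv_succ_eq_comp_right, iteratedFDeriv_succ_eq_comp_right]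
  simp only [Function.comp_apply]
  exact (congrArg norm
    ((continuousMultilinearCurryRightEquiv' ℝ n V W).symm.map_sub _ _).symm).trans (LinearIsometryEquiv.norm_map _ _)

/-- Currying is a linear isometry, so it transfers the Hölder bound on differences, not only the
norms. -/
theorem norm_iteratedFDeriv_two_sub (f : V → W) (a b : V) :
    ‖iteratedFDeriv ℝ 2 f a - iteratedFDeriv ℝ 2 f b‖ =
      ‖fderiv ℝ (fderiv ℝ f) a - fderiv ℝ (fderiv ℝ f) b‖ := by
  rw [norm_iteratedFDeriv_succ_sub 1 f, norm_iteratedFDeriv_succ_sub 0 (fderiv ℝ f),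
    iteratedFDeriv_zero_eq_comp]
  simp only [Function.comp_apply]
  rw [← LinearIsometryEquiv.map_sub, LinearIsometryEquiv.norm_map]

/-- Explicit form of the class `C^{2+γ}_b`. -/
structure HolderBounds (γ K : ℝ) (f : V → W) : Prop where
  nonneg : 0 ≤ K
  diff : Differentiable ℝ f
  diff' : Differentiable ℝ (fderiv ℝ f)
  bound : ∀ a, ‖f a‖ ≤ K
  bound' : ∀ a, ‖fderiv ℝ f a‖ ≤ K
  bound'' : ∀ a, ‖fderiv ℝ (fderiv ℝ f) a‖ ≤ K
  holder : ∀ a b, ‖fderiv ℝ (fderiv ℝ f) a - fderiv ℝ (fderiv ℝ f) b‖ ≤ K * ‖a - b‖ ^ γ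

theorem IsHolderClass.exists_holderBounds {γ : ℝ} {f : V → W} (hf : IsHolderClass 2 γ f) :
    ∃ K, HolderBounds γ K f := by
  obtain ⟨hc, hb, K₃, h3⟩ := hf
  obtain ⟨K₀, h0⟩ := hb 0 (by norm_num)
  obtain ⟨K₁, h1⟩ := hb 1 (by norm_num)
  obtain ⟨K₂, h2⟩ := hb 2 le_rfl
  refine ⟨max (max K₀ K₁) (max K₂ K₃), ?_, ?_, ?_, fun a => ?_, fun a => ?_, fun a => ?_,
    fun a b => ?_⟩
  · exact ((norm_nonneg _).trans (h0 0)).trans ((le_max_left _ _).trans (le_max_left _ _))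
  · exact hc.differentiable (by norm_num)
  · have : ContDiff ℝ 1 (fderiv ℝ f) := hc.fderiv_right (by norm_num)
    exact this.differentiable (by norm_num)
  · rw [← norm_iteratedFDeriv_zero (𝕜 := ℝ)]
    exact (h0 a).trans ((le_max_left _ _).trans (le_max_left _ _))
  · rw [← norm_iteratedFDeriv_one]
    exact (h1 a).trans ((le_max_right _ _).trans (le_max_left _ _))
  · rw [← norm_iteratedFDeriv_one, norm_iteratedFDeriv_fderiv]
    exact (h2 a).trans ((le_max_left _ _).trans (le_max_right _ _))
  · rw [← norm_iteratedFDeriv_two_sub]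
    exact (h3 a b).trans (mul_le_mul_of_nonneg_right
      ((le_max_right _ _).trans (le_max_right _ _)) (by positivity))

theorem lipschitz_of_fderiv {F : V → W} {K : ℝ} (hF : Differentiable ℝ F)
    (hK : ∀ a, ‖fderiv ℝ F a‖ ≤ K) (a b : V) : ‖F a - F b‖ ≤ K * ‖a - b‖ :=
  convex_univ.norm_image_sub_le_of_norm_fderiv_le (fun x _ => hF x) (fun x _ => hK x)
    (Set.mem_univ b) (Set.mem_univ a)

theorem hasDerivAt_comp_line {F : V → W} (hF : Differentiable ℝ F) (b c : V) (τ : ℝ) :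
    HasDerivAt (fun τ : ℝ => F (b + τ • c)) (fderiv ℝ F (b + τ • c) c) τ := by
  have h1 : HasDerivAt (fun τ : ℝ => b + τ • c) c τ := by
    simpa using ((hasDerivAt_id τ).smul_const c).const_add b
  exact (hF _).hasFDerivAt.comp_hasDerivAt τ h1

/-- Four-point estimate for a function with bounded Hölder derivative. -/
theorem four_point_of_holder {F : V → W} {K H γ m : ℝ} (hγ : 0 ≤ γ) (hH : 0 ≤ H)
    (hF : Differentiable ℝ F) (hK : ∀ a, ‖fderiv ℝ F a‖ ≤ K)
    (hHol : ∀ a b, ‖fderiv ℝ F a - fderiv ℝ F b‖ ≤ H * ‖a - b‖ ^ γ) (a b a' b' : V)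
    (ha : ‖a - a'‖ ≤ m) (hb : ‖b - b'‖ ≤ m) :
    ‖(F a - F b) - (F a' - F b')‖ ≤ K * ‖(a - b) - (a' - b')‖ + H * m ^ γ * ‖a' - b'‖ := by
  -- Mean value inequality along the segments from `b` to `a` and from `b'` to `a'`, which by
  -- convexity stay within `m` of each other at equal parameters.
  have := norm_image_sub_le_of_norm_deriv_le_segment_01'
    (f := fun τ : ℝ => F (b + τ • (a - b)) - F (b' + τ • (a' - b')))
    (f' := fun τ => fderiv ℝ F (b + τ • (a - b)) (a - b) -
      fderiv ℝ F (b' + τ • (a' - b')) (a' - b'))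
    (C := K * ‖(a - b) - (a' - b')‖ + H * m ^ γ * ‖a' - b'‖)
    (fun τ _ => ((hasDerivAt_comp_line hF b (a - b) τ).sub
      (hasDerivAt_comp_line hF b' (a' - b') τ)).hasDerivWithinAt)
    (fun τ hτ => by
      set p := b + τ • (a - b)
      set p' := b' + τ • (a' - b')
      have hp : ‖p - p'‖ ≤ m := by
        have : p - p' = (1 - τ) • (b - b') + τ • (a - a') := by
          simp only [p, p', smul_sub, sub_smul, one_smul]; abel
        rw [this]
        refine (norm_add_le _ _).trans ?_
        rw [norm_smul, norm_smul, Real.norm_of_nonneg hτ.1,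
          Real.norm_of_nonneg (by linarith [hτ.2])]
        nlinarith [mul_le_mul_of_nonneg_left ha hτ.1,
          mul_le_mul_of_nonneg_left hb (by linarith [hτ.2] : 0 ≤ 1 - τ)]
      have : fderiv ℝ F p (a - b) - fderiv ℝ F p' (a' - b') =
          fderiv ℝ F p ((a - b) - (a' - b')) + (fderiv ℝ F p - fderiv ℝ F p') (a' - b') := by
        simp only [map_sub, sub_apply]; abel
      rw [this]
      refine norm_add_le_of_le ((ContinuousLinearMap.le_opNorm _ _).trans
        (mul_le_mul_of_nonneg_right (hK _) (norm_nonneg _)))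
        ((ContinuousLinearMap.le_opNorm _ _).trans
        (mul_le_mul_of_nonneg_right ((hHol _ _).trans ?_) (norm_nonneg _)))
      gcongr)
  simp only [one_smul, add_sub_cancel, zero_smul, add_zero] at this
  rwa [sub_sub_sub_comm] at this

/-- Dependence of the first-order Taylor remainder on the base point and on the increment. -/
theorem taylor_remainder_sub {F : V → W} {K γ m : ℝ} (hγ : 0 ≤ γ) (hF : HolderBounds γ K F)
    (a h a' h' : V) (hh : ‖h‖ ≤ m) (hh' : ‖h'‖ ≤ m) :
    ‖(F (a + h) - F a - fderiv ℝ F a h) - (F (a' + h') - F a' - fderiv ℝ F a' h')‖ ≤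
      2 * K * m * ‖h - h'‖ + K * m ^ γ * m * ‖a - a'‖ := by
  have hK := hF.nonneg
  have hm : 0 ≤ m := (norm_nonneg _).trans hh
  have hderiv : ∀ (b c : V) (τ : ℝ), HasDerivAt (fun τ : ℝ => F (b + τ • c) - τ • fderiv ℝ F b c)
      ((fderiv ℝ F (b + τ • c) - fderiv ℝ F b) c) τ := fun b c τ => by
    simpa using (hasDerivAt_comp_line hF.diff b c τ).fun_sub
      ((hasDerivAt_id τ).smul_const (fderiv ℝ F b c))
  -- The increment over `[0,1]` of `τ ↦ F (a + τ h) - τ dF(a) h` is the Taylor remainder. Its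
  -- derivative involves an increment of `dF`, to which the four-point estimate applies.
  have := norm_image_sub_le_of_norm_deriv_le_segment_01'
    (f := fun τ : ℝ => (F (a + τ • h) - τ • fderiv ℝ F a h) -
      (F (a' + τ • h') - τ • fderiv ℝ F a' h'))
    (f' := fun τ => (fderiv ℝ F (a + τ • h) - fderiv ℝ F a) h -
      (fderiv ℝ F (a' + τ • h') - fderiv ℝ F a') h')
    (C := 2 * K * m * ‖h - h'‖ + K * m ^ γ * m * ‖a - a'‖)
    (fun τ _ => ((hderiv a h τ).sub (hderiv a' h' τ)).hasDerivWithinAt)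
    (fun τ hτ => by
      have hτ1 : ∀ v : V, ‖τ • v‖ ≤ ‖v‖ := fun v => by
        rw [norm_smul, Real.norm_of_nonneg hτ.1]
        exact mul_le_of_le_one_left (norm_nonneg _) hτ.2.le
      have h1 : ‖fderiv ℝ F (a + τ • h) - fderiv ℝ F a‖ ≤ K * m := by
        refine (lipschitz_of_fderiv hF.diff' hF.bound'' _ _).trans ?_
        rw [add_sub_cancel_left]
        exact mul_le_mul_of_nonneg_left ((hτ1 h).trans hh) hK
      have h2 : ‖(fderiv ℝ F (a + τ • h) - fderiv ℝ F a) -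
          (fderiv ℝ F (a' + τ • h') - fderiv ℝ F a')‖ ≤
          K * ‖h - h'‖ + K * m ^ γ * ‖a - a'‖ := by
        have := four_point_of_holder (m := m) hγ hK hF.diff' hF.bound'' hF.holder (a + τ • h)
          (a' + τ • h') a a' (by rw [add_sub_cancel_left]; exact (hτ1 h).trans hh)
          (by rw [add_sub_cancel_left]; exact (hτ1 h').trans hh')
        rw [sub_sub_sub_comm] at this
        refine this.trans (add_le_add_left (mul_le_mul_of_nonneg_left ?_ hK) _)
        rw [add_sub_add_comm, add_sub_cancel_left, ← smul_sub]
        exact hτ1 _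
      have h3 : (fderiv ℝ F (a + τ • h) - fderiv ℝ F a) h -
          (fderiv ℝ F (a' + τ • h') - fderiv ℝ F a') h' =
          (fderiv ℝ F (a + τ • h) - fderiv ℝ F a) (h - h') +
          ((fderiv ℝ F (a + τ • h) - fderiv ℝ F a) -
            (fderiv ℝ F (a' + τ • h') - fderiv ℝ F a')) h' := by
        simp only [map_sub, sub_apply]; abel
      rw [h3]
      refine (norm_add_le_of_le (ContinuousLinearMap.le_of_opNorm_le _ h1 _)
        (ContinuousLinearMap.le_of_opNorm_le_of_le _ h2 hh')).trans (le_of_eq ?_)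
      ring)
  simp only [one_smul, zero_smul, add_zero, sub_zero] at this
  refine le_trans (le_of_eq ?_) this
  congr 1; abel

theorem taylor_remainder_le {F : V → W} {K γ m : ℝ} (hγ : 0 ≤ γ) (hF : HolderBounds γ K F)
    (a h : V) (hh : ‖h‖ ≤ m) :
    ‖F (a + h) - F a - fderiv ℝ F a h‖ ≤ 2 * K * m * m := by
  have hK := hF.nonneg
  have hm : 0 ≤ m := (norm_nonneg _).trans hh
  have := taylor_remainder_sub hγ hF a h a 0 hh (by simpa using hm)
  simp only [add_zero, sub_self, map_zero, sub_zero, norm_zero, mul_zero] at this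
  exact this.trans (by gcongr)

/-- A bounded Lipschitz increment is bounded by a Hölder increment. -/
theorem le_rpow_of_le {x y K γ : ℝ} (hγ : 0 ≤ γ) (hγ1 : γ ≤ 1) (hK : 0 ≤ K) (hy : 0 ≤ y)
    (h1 : x ≤ 2 * K) (h2 : x ≤ K * y) : x ≤ 2 * K * y ^ γ := by
  rcases le_total y 1 with hy1 | hy1
  · have : y ≤ y ^ γ := by
      rcases hy.eq_or_lt with rfl | hy0
      · positivity
      · simpa using Real.rpow_le_rpow_of_exponent_ge hy0 hy1 hγ1
    have : K * y ≤ K * y ^ γ := by gcongr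
    have : 0 ≤ K * y ^ γ := by positivity
    linarith
  · have : 1 ≤ y ^ γ := Real.one_le_rpow hy1 hγ
    nlinarith

end Calculus

/-! ### Bilinear maps on the projective tensor square. -/

section Rough

variable {U : Type*} [NormedAddCommGroup U] [NormedSpace ℝ U]
variable {V : Type*} [NormedAddCommGroup V] [NormedSpace ℝ V] [CompleteSpace V]

theorem liftBilinear_coe (B : U →L[ℝ] U →L[ℝ] V) (X : ⨂[ℝ] _ : Fin 2, U) :
    liftBilinear B (X : TensorSquare U) = PiTensorProduct.liftIsometry ℝ (fun _ : Fin 2 => U) V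
      (ContinuousLinearMap.uncurryLeft (Ei := fun _ : Fin 2 => U)
        ((continuousMultilinearCurryFin1 ℝ U V).symm.toContinuousLinearEquiv.toContinuousLinearMap
          ∘L B)) X :=
  ContinuousLinearMap.extend_eq _
    (e := UniformSpace.Completion.toComplL (𝕜 := ℝ) (E := ⨂[ℝ] _ : Fin 2, U))
    UniformSpace.Completion.denseRange_coe
    (UniformSpace.Completion.isUniformInducing_coe _) X

theorem liftBilinear_sub (B B' : U →L[ℝ] U →L[ℝ] V) :
    liftBilinear (B - B') = liftBilinear B - liftBilinear B' := by
  ext X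
  induction X using UniformSpace.Completion.induction_on with
  | hp => exact isClosed_eq (ContinuousLinearMap.continuous _) (ContinuousLinearMap.continuous _)
  | ih X =>
    rw [sub_apply, liftBilinear_coe, liftBilinear_coe, liftBilinear_coe, ← sub_apply, ← map_sub]
    rfl

/-- Currying and the universal property of the projective norm are isometric; density carries the
bound to the completion. -/
theorem norm_liftBilinear_le (B : U →L[ℝ] U →L[ℝ] V) : ‖liftBilinear B‖ ≤ ‖B‖ := by
  refine ContinuousLinearMap.opNorm_le_bound _ (norm_nonneg B) fun X => ?_
  induction X using UniformSpace.Completion.induction_on with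
  | hp => exact isClosed_le (ContinuousLinearMap.continuous _).norm (by fun_prop)
  | ih X =>
    rw [liftBilinear_coe, UniformSpace.Completion.norm_coe]
    refine ContinuousLinearMap.le_of_opNorm_le _ ?_ _
    rw [LinearIsometryEquiv.norm_map, ContinuousLinearMap.uncurryLeft_norm]
    refine ContinuousLinearMap.opNorm_le_bound _ (norm_nonneg B) fun u => ?_
    refine le_trans (le_of_eq ?_) (B.le_opNorm u)
    exact LinearIsometryEquiv.norm_map (continuousMultilinearCurryFin1 ℝ U V).symm (B u)

end Rough

/-! ### One step of the Davie expansion and its defect. -/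

section Davie

variable {U : Type*} [NormedAddCommGroup U] [NormedSpace ℝ U]
variable {V : Type*} [NormedAddCommGroup V] [NormedSpace ℝ V] [CompleteSpace V]

/-- The second-order coefficient `df(a) · f(a)` of the Davie expansion, as a linear map on the
tensor square. -/
def secondOrder (f : V → U →L[ℝ] V) (a : V) : TensorSquare U →L[ℝ] V :=
  liftBilinear ((fderiv ℝ f a) ∘L (f a))

/-- One step of the Davie expansion. -/
def davieStep (f : V → U →L[ℝ] V) (u : U) (X : TensorSquare U) (a : V) : V :=
  a + f a u + secondOrder f a X

variable {γ K : ℝ} {f : V → U →L[ℝ] V}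

theorem norm_secondOrder_le (hf : HolderBounds γ K f) (a : V) : ‖secondOrder f a‖ ≤ K * K :=
  (norm_liftBilinear_le _).trans ((ContinuousLinearMap.opNorm_comp_le _ _).trans
    (mul_le_mul (hf.bound' a) (hf.bound a) (norm_nonneg _) hf.nonneg))

theorem norm_secondOrder_sub_le (hf : HolderBounds γ K f) (a b : V) :
    ‖secondOrder f a - secondOrder f b‖ ≤ 2 * (K * K) * ‖a - b‖ := by
  have hK := hf.nonneg
  rw [secondOrder, secondOrder, ← liftBilinear_sub]
  refine (norm_liftBilinear_le _).trans ?_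
  have : (fderiv ℝ f a) ∘L (f a) - (fderiv ℝ f b) ∘L (f b) =
      (fderiv ℝ f a - fderiv ℝ f b) ∘L (f a) + (fderiv ℝ f b) ∘L (f a - f b) := by
    ext u v; simp
  rw [this]
  have h1 := lipschitz_of_fderiv hf.diff' hf.bound'' a b
  have h2 := lipschitz_of_fderiv hf.diff hf.bound' a b
  refine (norm_add_le_of_le
    ((ContinuousLinearMap.opNorm_comp_le _ _).trans
      (mul_le_mul h1 (hf.bound a) (norm_nonneg _) (by positivity)))
    ((ContinuousLinearMap.opNorm_comp_le _ _).trans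
      (mul_le_mul (hf.bound' b) h2 (norm_nonneg _) hK))).trans (le_of_eq ?_)
  ring

/-- Product rule for double differences. Bounded Lipschitz maps are also `γ`-Hölder, which puts all
cross terms in the form `m ^ γ ‖a' - b'‖`; the four terms contribute `1 + 2 + 2 + 2 = 7`. -/
theorem norm_secondOrder_four_point (hf : HolderBounds γ K f) (hγ : 0 ≤ γ) (hγ1 : γ ≤ 1)
    {m : ℝ} (a b a' b' : V) (ha : ‖a - a'‖ ≤ m) (hb : ‖b - b'‖ ≤ m) :
    ‖(secondOrder f a - secondOrder f b) - (secondOrder f a' - secondOrder f b')‖ ≤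
      2 * (K * K) * ‖(a - b) - (a' - b')‖ + 7 * (K * K) * m ^ γ * ‖a' - b'‖ := by
  have hK := hf.nonneg
  have hm : 0 ≤ m := (norm_nonneg _).trans ha
  simp only [secondOrder]
  rw [← liftBilinear_sub, ← liftBilinear_sub, ← liftBilinear_sub]
  refine (norm_liftBilinear_le _).trans ?_
  set P := fderiv ℝ f
  have hdecomp : ((P a) ∘L (f a) - (P b) ∘L (f b)) - ((P a') ∘L (f a') - (P b') ∘L (f b')) =
      ((P a - P b) - (P a' - P b')) ∘L (f a) + (P a' - P b') ∘L (f a - f a') +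
      (P b) ∘L ((f a - f b) - (f a' - f b')) + (P b - P b') ∘L (f a' - f b') := by
    ext u v
    simp only [sub_apply, ContinuousLinearMap.comp_apply, add_apply, map_sub]
    abel
  rw [hdecomp]
  have hfL := lipschitz_of_fderiv hf.diff hf.bound'
  have hPL := lipschitz_of_fderiv hf.diff' hf.bound''
  have hfγ : ∀ a b, ‖f a - f b‖ ≤ 2 * K * ‖a - b‖ ^ γ := fun a b =>
    le_rpow_of_le hγ hγ1 hK (norm_nonneg _)
      ((norm_sub_le_of_le (hf.bound a) (hf.bound b)).trans (by linarith)) (hfL a b)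
  have hPγ : ∀ a b, ‖P a - P b‖ ≤ 2 * K * ‖a - b‖ ^ γ := fun a b =>
    le_rpow_of_le hγ hγ1 hK (norm_nonneg _)
      ((norm_sub_le_of_le (hf.bound' a) (hf.bound' b)).trans (by linarith)) (hPL a b)
  have hmono : ∀ x, 0 ≤ x → x ≤ m → 2 * K * x ^ γ ≤ 2 * K * m ^ γ := fun x hx hxm => by gcongr
  have h1 := four_point_of_holder hγ hK hf.diff' hf.bound'' hf.holder a b a' b' ha hb
  have h2 := (hfγ a a').trans (hmono _ (norm_nonneg _) ha)
  have h3 := four_point_of_holder (H := 2 * K) hγ (by positivity) hf.diff hf.bound' hPγ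
    a b a' b' ha hb
  have h4 := (hPγ b b').trans (hmono _ (norm_nonneg _) hb)
  have comp_le : ∀ {A : V →L[ℝ] U →L[ℝ] V} {B : U →L[ℝ] V} {x y : ℝ}, ‖A‖ ≤ x → ‖B‖ ≤ y →
      ‖A ∘L B‖ ≤ x * y := fun {A} _ _ _ hA hB => (ContinuousLinearMap.opNorm_comp_le _ _).trans
    (mul_le_mul hA hB (norm_nonneg _) ((norm_nonneg A).trans hA))
  refine (norm_add₄_le (E := U →L[ℝ] U →L[ℝ] V)).trans ?_
  refine (add_le_add (add_le_add (add_le_add (comp_le h1 (hf.bound a))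
    (comp_le (hPL a' b') h2)) (comp_le (hf.bound' b) h3)) (comp_le h4 (hfL a' b'))).trans
    (le_of_eq ?_)
  ring

variable {c₁ c₂ : ℝ}

/-- The factor `2` is not needed here; it makes the bound coincide with the Lipschitz constant of
`norm_davieStep_sub_sub_le`. -/
theorem norm_davieStep_sub_le (hf : HolderBounds γ K f) {u : U} {X : TensorSquare U}
    (hu : ‖u‖ ≤ c₁) (hX : ‖X‖ ≤ c₂) (a : V) :
    ‖davieStep f u X a - a‖ ≤ K * c₁ + 2 * (K * K) * c₂ := by
  have : davieStep f u X a - a = f a u + secondOrder f a X := by rw [davieStep]; abel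
  rw [this]
  have hK := hf.nonneg
  have hc : 0 ≤ c₂ := (norm_nonneg _).trans hX
  refine norm_add_le_of_le (ContinuousLinearMap.le_of_opNorm_le_of_le _ (hf.bound a) hu)
    ((ContinuousLinearMap.le_of_opNorm_le_of_le _ (norm_secondOrder_le hf a) hX).trans ?_)
  have : 0 ≤ K * K * c₂ := by positivity
  linarith

theorem norm_davieStep_sub_sub_le (hf : HolderBounds γ K f) {u : U} {X : TensorSquare U}
    (hu : ‖u‖ ≤ c₁) (hX : ‖X‖ ≤ c₂) (a b : V) :
    ‖(davieStep f u X a - a) - (davieStep f u X b - b)‖ ≤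
      (K * c₁ + 2 * (K * K) * c₂) * ‖a - b‖ := by
  have : (davieStep f u X a - a) - (davieStep f u X b - b) =
      (f a - f b) u + (secondOrder f a - secondOrder f b) X := by
    simp only [davieStep, sub_apply]; abel
  rw [this]
  refine (norm_add_le_of_le
    (ContinuousLinearMap.le_of_opNorm_le_of_le _ (lipschitz_of_fderiv hf.diff hf.bound' a b) hu)
    (ContinuousLinearMap.le_of_opNorm_le_of_le _ (norm_secondOrder_sub_le hf a b) hX)).trans
    (le_of_eq ?_)
  ring

theorem norm_davieStep_four_point (hf : HolderBounds γ K f) (hγ : 0 ≤ γ) (hγ1 : γ ≤ 1) {u : U}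
    {X : TensorSquare U} (hu : ‖u‖ ≤ c₁) (hX : ‖X‖ ≤ c₂) {m : ℝ} (a b a' b' : V)
    (ha : ‖a - a'‖ ≤ m) (hb : ‖b - b'‖ ≤ m) :
    ‖(davieStep f u X a - davieStep f u X b) - (davieStep f u X a' - davieStep f u X b')‖ ≤
      (1 + (K * c₁ + 2 * (K * K) * c₂)) * ‖(a - b) - (a' - b')‖ +
        (K * m * c₁ + 7 * (K * K) * m ^ γ * c₂) * ‖a' - b'‖ := by
  have : (davieStep f u X a - davieStep f u X b) - (davieStep f u X a' - davieStep f u X b') =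
      ((a - b) - (a' - b')) + ((f a - f b) - (f a' - f b')) u +
      ((secondOrder f a - secondOrder f b) - (secondOrder f a' - secondOrder f b')) X := by
    simp only [davieStep, sub_apply]; abel
  rw [this]
  have h1 := four_point_of_holder zero_le_one hf.nonneg hf.diff hf.bound'
    (fun a b => by rw [Real.rpow_one]; exact lipschitz_of_fderiv hf.diff' hf.bound'' a b)
    a b a' b' ha hb
  rw [Real.rpow_one] at h1
  refine (norm_add_le_of_le (norm_add_le_of_le le_rfl
    (ContinuousLinearMap.le_of_opNorm_le_of_le _ h1 hu))
    (ContinuousLinearMap.le_of_opNorm_le_of_le _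
      (norm_secondOrder_four_point hf hγ hγ1 a b a' b' ha hb) hX)).trans (le_of_eq ?_)
  ring

/-- The term `df(a)(f(a) u) u'` in the Taylor expansion of `f` is exactly what `u ⊗ u'` in Chen's
relation produces. What survives is of third order when `u` counts once and `X` twice. -/
theorem davieStep_defect (f : V → U →L[ℝ] V) (u u' : U) (X X' : TensorSquare U) (a : V) :
    davieStep f u' X' (davieStep f u X a) - davieStep f (u + u') (X + X' + tmul u u') a =
      (f (a + (davieStep f u X a - a)) - f a - fderiv ℝ f a (davieStep f u X a - a)) u' +
      fderiv ℝ f a (secondOrder f a X) u' +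
      (secondOrder f (a + (davieStep f u X a - a)) - secondOrder f a) X' := by
  rw [add_sub_cancel]
  have h : davieStep f u X a - a = f a u + secondOrder f a X := by rw [davieStep]; abel
  have htm : secondOrder f a (tmul u u') = fderiv ℝ f a (f a u) u' := by
    rw [secondOrder, liftBilinear_tmul]; rfl
  rw [h]
  simp only [davieStep, map_add, sub_apply, add_apply, htm]
  abel

theorem norm_davieStep_defect_le (hf : HolderBounds γ K f) (hγ : 0 ≤ γ) {u u' : U}
    {X X' : TensorSquare U} (hu : ‖u‖ ≤ c₁) (hu' : ‖u'‖ ≤ c₁) (hX : ‖X‖ ≤ c₂) (hX' : ‖X'‖ ≤ c₂)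
    {μ : ℝ} (hμ : K * c₁ + 2 * (K * K) * c₂ ≤ μ) (a : V) :
    ‖davieStep f u' X' (davieStep f u X a) - davieStep f (u + u') (X + X' + tmul u u') a‖ ≤
      2 * K * μ * μ * c₁ + K * (K * K * c₂) * c₁ + 2 * (K * K) * μ * c₂ := by
  rw [davieStep_defect]
  have hK := hf.nonneg
  have hh := (norm_davieStep_sub_le hf hu hX a).trans hμ
  set h := davieStep f u X a - a
  refine norm_add_le_of_le (norm_add_le_of_le ?_ ?_) ?_
  · exact ContinuousLinearMap.le_of_opNorm_le_of_le _ (taylor_remainder_le hγ hf a h hh) hu'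
  · exact ContinuousLinearMap.le_of_opNorm_le_of_le _
      (ContinuousLinearMap.le_of_opNorm_le_of_le _ (hf.bound' a)
        (ContinuousLinearMap.le_of_opNorm_le_of_le _ (norm_secondOrder_le hf a) hX)) hu'
  · refine ContinuousLinearMap.le_of_opNorm_le_of_le _
      ((norm_secondOrder_sub_le hf (a + h) a).trans ?_) hX'
    rw [add_sub_cancel_left]
    exact mul_le_mul_of_nonneg_left hh (by positivity)

/-- Varying the base point uses up one derivative: differences of `d²f` are only Hölder, whence the
factors `μ ^ γ` and the order `2 + γ` instead of `3`. -/
theorem norm_davieStep_defect_sub_le (hf : HolderBounds γ K f) (hγ : 0 ≤ γ) (hγ1 : γ ≤ 1)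
    {u u' : U} {X X' : TensorSquare U} (hu : ‖u‖ ≤ c₁) (hu' : ‖u'‖ ≤ c₁) (hX : ‖X‖ ≤ c₂)
    (hX' : ‖X'‖ ≤ c₂) {μ : ℝ} (hμ : K * c₁ + 2 * (K * K) * c₂ ≤ μ) (a b : V) :
    ‖(davieStep f u' X' (davieStep f u X a) - davieStep f (u + u') (X + X' + tmul u u') a) -
      (davieStep f u' X' (davieStep f u X b) - davieStep f (u + u') (X + X' + tmul u u') b)‖ ≤
      ((2 * K * μ * μ + K * μ ^ γ * μ) * c₁ + 3 * K * (K * K * c₂) * c₁ +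
        (2 * (K * K) * μ + 7 * (K * K) * μ ^ γ) * c₂) * ‖a - b‖ := by
  rw [davieStep_defect, davieStep_defect]
  have hK := hf.nonneg
  have ha := (norm_davieStep_sub_le hf hu hX a).trans hμ
  have hb := (norm_davieStep_sub_le hf hu hX b).trans hμ
  have hab := (norm_davieStep_sub_sub_le hf hu hX a b).trans
    (mul_le_mul_of_nonneg_right hμ (norm_nonneg _))
  set h := davieStep f u X a - a
  set k := davieStep f u X b - b
  have hμ0 : 0 ≤ μ := (norm_nonneg _).trans ha
  rw [add_sub_add_comm, add_sub_add_comm, ← sub_apply, ← sub_apply, ← sub_apply]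
  have h1 := ContinuousLinearMap.le_of_opNorm_le_of_le _
    ((taylor_remainder_sub hγ hf a h b k ha hb).trans
      (add_le_add_left (mul_le_mul_of_nonneg_left hab (by positivity : 0 ≤ 2 * K * μ)) _)) hu'
  have h2 : ‖(fderiv ℝ f a (secondOrder f a X) - fderiv ℝ f b (secondOrder f b X)) u'‖ ≤
      3 * K * (K * K * c₂) * ‖a - b‖ * c₁ := by
    have e : fderiv ℝ f a (secondOrder f a X) - fderiv ℝ f b (secondOrder f b X) =
        (fderiv ℝ f a - fderiv ℝ f b) (secondOrder f a X) +
        fderiv ℝ f b ((secondOrder f a - secondOrder f b) X) := by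
      simp only [sub_apply, map_sub]; abel
    rw [e]
    refine ContinuousLinearMap.le_of_opNorm_le_of_le _ ((norm_add_le_of_le
      (ContinuousLinearMap.le_of_opNorm_le_of_le _
        (lipschitz_of_fderiv hf.diff' hf.bound'' a b)
        (ContinuousLinearMap.le_of_opNorm_le_of_le _ (norm_secondOrder_le hf a) hX))
      (ContinuousLinearMap.le_of_opNorm_le_of_le _ (hf.bound' b)
        (ContinuousLinearMap.le_of_opNorm_le_of_le _
          (norm_secondOrder_sub_le hf a b) hX))).trans (le_of_eq ?_)) hu'
    ring
  have h3 : ‖((secondOrder f (a + h) - secondOrder f a) -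
      (secondOrder f (b + k) - secondOrder f b)) X'‖ ≤
      (2 * (K * K) * (μ * ‖a - b‖) + 7 * (K * K) * μ ^ γ * ‖a - b‖) * c₂ := by
    refine ContinuousLinearMap.le_of_opNorm_le_of_le _ ?_ hX'
    rw [sub_sub_sub_comm]
    refine (norm_secondOrder_four_point (m := μ) hf hγ hγ1 (a + h) (b + k) a b
      (by rwa [add_sub_cancel_left]) (by rwa [add_sub_cancel_left])).trans
      (add_le_add_left (mul_le_mul_of_nonneg_left ?_ (by positivity)) _)
    rwa [add_sub_add_comm, add_sub_cancel_left]
  refine (norm_add_le_of_le (norm_add_le_of_le h1 h2) h3).trans (le_of_eq ?_)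
  ring

end Davie

/-! ### The Davie expansion along a rough path. -/

section DavieFamily

variable {U : Type*} [NormedAddCommGroup U] [NormedSpace ℝ U]
variable {V : Type*} [NormedAddCommGroup V] [NormedSpace ℝ V] [CompleteSpace V]
variable {T p γ K : ℝ} {ω : ℝ → ℝ → ℝ} {f : V → U →L[ℝ] V}

/-- Both levels are expressed through `w ^ (1 / p)`, so later estimates are algebra in one quantity;
a free `w` allows the control of a larger interval. -/
theorem RoughPath.exists_bound (x : RoughPath T p ω U) (hω : IsControl T ω) (hp : 0 < p) :
    ∃ C ≥ 0, ∀ s t, 0 ≤ s → s ≤ t → t ≤ T → ∀ w, ω s t ≤ w →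
      ‖x.fst s t‖ ≤ C * w ^ (1 / p) ∧ ‖x.snd s t‖ ≤ C * (w ^ (1 / p)) ^ 2 := by
  obtain ⟨C, hC⟩ := x.bound
  refine ⟨|C|, abs_nonneg C, fun s t hs hst ht w hw => ?_⟩
  have h0 := hω.nonneg s t hs hst ht
  obtain ⟨h1, h2⟩ := hC s t hs hst ht
  have e : (w ^ (1 / p)) ^ 2 = w ^ (2 / p) := by
    rw [← Real.rpow_natCast, ← Real.rpow_mul (h0.trans hw)]; congr 1; push_cast; ring
  rw [e]
  constructor
  · exact h1.trans (mul_le_mul (le_abs_self C) (Real.rpow_le_rpow h0 hw (by positivity))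
      (by positivity) (abs_nonneg C))
  · exact h2.trans (mul_le_mul (le_abs_self C) (Real.rpow_le_rpow h0 hw (by positivity))
      (by positivity) (abs_nonneg C))

theorem rpow_remainder {w : ℝ} (hw : 0 ≤ w) (hγ : 0 < γ) :
    w ^ ((2 + γ) / p) = (w ^ (1 / p)) ^ 2 * (w ^ (1 / p)) ^ γ := by
  have e : (2 + γ) / p = 1 / p * (2 + γ) := by ring
  rw [e, Real.rpow_mul hw, Real.rpow_add' (by positivity) (by positivity), Real.rpow_two]

/-- The Davie expansion is a Lipschitz perturbation of the identity of order `ω ^ (1/p)`. -/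
theorem davie_near (hf : HolderBounds γ K f) (x : RoughPath T p ω U) (hω : IsControl T ω)
    (hp : 0 < p) :
    ∃ N ≥ 0, ∀ s t, 0 ≤ s → s ≤ t → t ≤ T →
      (∀ a, ‖davie f x t s a - a‖ ≤ N * ω s t ^ (1 / p)) ∧
      ∀ a b, ‖(davie f x t s a - a) - (davie f x t s b - b)‖ ≤ N * ω s t ^ (1 / p) * ‖a - b‖ := by
  obtain ⟨C, hC, hx⟩ := x.exists_bound hω hp
  have hK := hf.nonneg
  set E := ω 0 T ^ (1 / p)
  by_cases hT : 0 ≤ T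
  swap
  · exact ⟨0, le_rfl, fun s t hs hst ht => absurd (hs.trans (hst.trans ht)) hT⟩
  have hE : 0 ≤ E := Real.rpow_nonneg (hω.nonneg 0 T le_rfl hT le_rfl) _
  have key : ∀ s t, 0 ≤ s → s ≤ t → t ≤ T →
      K * (C * ω s t ^ (1 / p)) + 2 * (K * K) * (C * (ω s t ^ (1 / p)) ^ 2) ≤
      (K * C + 2 * (K * K) * C * E) * ω s t ^ (1 / p) := fun s t hs hst ht => by
    have h0 := hω.nonneg s t hs hst ht
    have he : 0 ≤ ω s t ^ (1 / p) := by positivity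
    have heE : ω s t ^ (1 / p) ≤ E :=
      Real.rpow_le_rpow h0 (hω.mono le_rfl hs hst ht le_rfl) (by positivity)
    have := mul_le_mul_of_nonneg_left heE
      (by positivity : 0 ≤ 2 * (K * K) * C * ω s t ^ (1 / p))
    nlinarith
  refine ⟨K * C + 2 * (K * K) * C * E, by positivity, fun s t hs hst ht => ⟨fun a => ?_,
    fun a b => ?_⟩⟩
  · obtain ⟨h1, h2⟩ := hx s t hs hst ht _ le_rfl
    exact (norm_davieStep_sub_le hf h1 h2 a).trans (key s t hs hst ht)
  · obtain ⟨h1, h2⟩ := hx s t hs hst ht _ le_rfl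
    exact (norm_davieStep_sub_sub_le hf h1 h2 a b).trans
      (mul_le_mul_of_nonneg_right (key s t hs hst ht) (norm_nonneg _))

/-- The defect of the Davie expansion from being a flow is bounded and Lipschitz, with constants of
the order of the remainder. -/
theorem davie_defect (hf : HolderBounds γ K f) (x : RoughPath T p ω U) (hω : IsControl T ω)
    (hp : 0 < p) (hγ : 0 < γ) (hγ1 : γ ≤ 1) :
    ∃ M ≥ 0, ∀ r s t, 0 ≤ r → r ≤ s → s ≤ t → t ≤ T →
      (∀ a, ‖davie f x t s (davie f x s r a) - davie f x t r a‖ ≤ M * ω r t ^ ((2 + γ) / p)) ∧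
      ∀ a b, ‖(davie f x t s (davie f x s r a) - davie f x t r a) -
        (davie f x t s (davie f x s r b) - davie f x t r b)‖ ≤
        M * ω r t ^ ((2 + γ) / p) * ‖a - b‖ := by
  obtain ⟨C, hC, hx⟩ := x.exists_bound hω hp
  have hK := hf.nonneg
  by_cases hT : 0 ≤ T
  swap
  · exact ⟨0, le_rfl, fun r s t hr hrs hst ht =>
      absurd (hr.trans (hrs.trans (hst.trans ht))) hT⟩
  -- The summand `1` gives `E ≥ 1`, hence `e ^ (1 - γ) ≤ E` and `e ≤ E * e ^ γ` below.
  set E := ω 0 T ^ (1 / p) + 1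
  have hE : 1 ≤ E := by
    have := Real.rpow_nonneg (hω.nonneg 0 T le_rfl hT le_rfl) (1 / p)
    linarith
  set K₁ := K * C + 2 * (K * K) * C * E with hK₁
  have hK₁0 : 0 ≤ K₁ := by positivity
  set k := K₁ ^ γ
  have hk0 : 0 ≤ k := by positivity
  -- `M₁` collects the coefficients of order `e ^ 3`, `M₂` those of order `e ^ (2 + γ)`.
  set M₁ := 2 * K * K₁ * K₁ * C + 3 * K * (K * K) * C * C + 2 * (K * K) * K₁ * C with hM₁
  set M₂ := K * k * K₁ * C + 7 * (K * K) * k * C with hM₂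
  have hM₁0 : 0 ≤ M₁ := by positivity
  have hM₂0 : 0 ≤ M₂ := by positivity
  refine ⟨E * M₁ + M₂, by positivity, fun r s t hr hrs hst ht => ?_⟩
  have h0 := hω.nonneg r t hr (hrs.trans hst) ht
  obtain ⟨h1, h2⟩ := hx r s hr hrs (hst.trans ht) _ (hω.mono hr le_rfl hrs hst ht)
  obtain ⟨h3, h4⟩ := hx s t (hr.trans hrs) hst ht _ (hω.mono hr hrs hst le_rfl ht)
  rw [rpow_remainder h0 hγ]
  have he : 0 ≤ ω r t ^ (1 / p) := by positivity
  have heE : ω r t ^ (1 / p) ≤ E :=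
    (Real.rpow_le_rpow h0 (hω.mono le_rfl hr (hrs.trans hst) ht le_rfl) (by positivity)).trans
      (by simp [E])
  have hdav : ∀ a, davie f x t r a = davieStep f (x.fst r s + x.fst s t)
      (x.snd r s + x.snd s t + tmul (x.fst r s) (x.fst s t)) a := fun a => by
    rw [← x.chen_fst r s t hr hrs hst ht, ← x.chen_snd r s t hr hrs hst ht]; rfl
  set e := ω r t ^ (1 / p)
  have hμ : K * (C * e) + 2 * (K * K) * (C * e ^ 2) ≤ K₁ * e := by
    have := mul_le_mul_of_nonneg_left heE (by positivity : 0 ≤ 2 * (K * K) * C * e)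
    rw [hK₁]; nlinarith
  have hg0 : 0 ≤ e ^ γ := by positivity
  have heg : e ≤ E * e ^ γ := by
    calc e = e ^ (1 - γ) * e ^ γ := by
          rw [← Real.rpow_add' he (by simp), sub_add_cancel, Real.rpow_one]
      _ ≤ E * e ^ γ := by
          refine mul_le_mul_of_nonneg_right ?_ hg0
          refine (Real.rpow_le_rpow he heE (by linarith)).trans ?_
          simpa using Real.rpow_le_rpow_of_exponent_le hE (by linarith : 1 - γ ≤ 1)
  have hμγ : (K₁ * e) ^ γ = k * e ^ γ := Real.mul_rpow hK₁0 he
  set g := e ^ γ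
  have hfin : (2 * K * (K₁ * e) * (K₁ * e) + K * (k * g) * (K₁ * e)) * (C * e) +
      3 * K * (K * K * (C * e ^ 2)) * (C * e) +
      (2 * (K * K) * (K₁ * e) + 7 * (K * K) * (k * g)) * (C * e ^ 2) ≤
      (E * M₁ + M₂) * (e ^ 2 * g) := by
    have := mul_le_mul_of_nonneg_left heg (by positivity : 0 ≤ M₁ * e ^ 2)
    calc _ = M₁ * e ^ 2 * e + M₂ * (e ^ 2 * g) := by rw [hM₁, hM₂]; ring
      _ ≤ M₁ * e ^ 2 * (E * g) + M₂ * (e ^ 2 * g) := add_le_add_left this _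
      _ = _ := by ring
  refine ⟨fun a => ?_, fun a b => ?_⟩
  · rw [hdav]
    refine (norm_davieStep_defect_le hf hγ.le h1 h3 h2 h4 hμ a).trans (le_trans ?_ hfin)
    have n1 : 0 ≤ K * (k * g) * (K₁ * e) * (C * e) := by positivity
    have n2 : 0 ≤ K * (K * K * (C * e ^ 2)) * (C * e) := by positivity
    have n3 : 0 ≤ 7 * (K * K) * (k * g) * (C * e ^ 2) := by positivity
    linarith
  · rw [hdav, hdav]
    have := norm_davieStep_defect_sub_le hf hγ.le hγ1 h1 h3 h2 h4 hμ a b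
    rw [hμγ] at this
    exact this.trans (mul_le_mul_of_nonneg_right hfin (norm_nonneg _))

theorem davie_self (f : V → U →L[ℝ] V) (x : RoughPath T p ω U) (hω : IsControl T ω) (hp : 0 < p)
    {t : ℝ} (ht : 0 ≤ t) (htT : t ≤ T) : davie f x t t = id := by
  obtain ⟨C, hC, hx⟩ := x.exists_bound hω hp
  obtain ⟨h1, h2⟩ := hx t t ht le_rfl htT _ le_rfl
  rw [hω.diag t ht htT, Real.zero_rpow (by positivity)] at h1 h2
  funext a
  have h1' : x.fst t t = 0 := by simpa using h1
  have h2' : x.snd t t = 0 := by simpa using h2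
  simp [davie, h1', h2']

open Filter Topology

/-- The Davie expansion is an almost flow. -/
theorem isAlmostFlow_davie (hf : HolderBounds γ K f) (x : RoughPath T p ω U) (hω : IsControl T ω)
    (hp : 0 < p) (hγ : 0 < γ) (hγ1 : γ ≤ 1) (hT : 0 < T) :
    IsAlmostFlow T ω (remainder p γ) (davie f x) := by
  obtain ⟨N, hN, hnear⟩ := davie_near hf x hω hp
  obtain ⟨M, hM, hdef⟩ := davie_defect hf x hω hp hγ hγ1
  have hω0 : ∀ u, 0 ≤ u → 0 ≤ ω 0 (min u T) := fun u hu =>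
    hω.nonneg _ _ le_rfl (le_min hu hT.le) (min_le_right _ _)
  have hle : ∀ T' s t, T' ≤ T → 0 ≤ s → s ≤ t → t ≤ T' →
      N * ω s t ^ (1 / p) ≤ N * ω 0 (min T' T) ^ (1 / p) := by
    intro T' s t hT' hs hst ht
    rw [min_eq_left hT']
    exact mul_le_mul_of_nonneg_left (Real.rpow_le_rpow (hω.nonneg s t hs hst (ht.trans hT'))
      (hω.mono le_rfl hs hst ht hT') (by positivity)) hN
  have hrem : ∀ s t, 0 ≤ s → s ≤ t → t ≤ T → 0 ≤ remainder p γ (ω s t) := fun s t hs hst ht =>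
    Real.rpow_nonneg (hω.nonneg s t hs hst ht) _
  -- `δ` is the displacement bound over the horizon, truncated at `T` because `ω` is controlled only
  -- there. The maps are Lipschitz, so `η = 0` suffices.
  refine ⟨fun s t hs hst ht => ?_, fun t ht htT => davie_self f x hω hp ht htT,
    fun u => N * ω 0 (min u T) ^ (1 / p), fun _ => 0, 1, M, fun u hu => ?_, fun u hu v hv huv => ?_,
    ?_, fun _ _ => le_rfl, monotoneOn_const, continuousOn_const, one_pos, le_rfl, hM,
    fun T' hT'0 hT' => ⟨fun s t hs hst ht => ?_, fun s t hs hst ht a => ?_,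
      fun s t hs hst ht a b => ?_, fun r s t hr hrs hst ht a => ?_⟩⟩
  · have hL : LipschitzWith (N * ω s t ^ (1 / p)).toNNReal fun a => davie f x t s a - a := by
      refine LipschitzWith.of_dist_le_mul fun a b => ?_
      rw [dist_eq_norm, dist_eq_norm, Real.coe_toNNReal _
        (mul_nonneg hN (Real.rpow_nonneg (hω.nonneg s t hs hst ht) _))]
      exact (hnear s t hs hst ht).2 a b
    convert hL.continuous.add continuous_id using 1
    ext a
    simp
  · exact mul_nonneg hN (Real.rpow_nonneg (hω0 u hu) _)
  · refine mul_le_mul_of_nonneg_left (Real.rpow_le_rpow (hω0 u hu) ?_ (by positivity)) hN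
    exact hω.mono le_rfl le_rfl (le_min hu hT.le) (min_le_min_right _ huv) (min_le_right _ _)
  · have h1 : Tendsto (fun u : ℝ => ω 0 (min u T)) (𝓝[>] 0) (𝓝 0) := by
      have hc := hω.continuous_diag 0 le_rfl hT.le
      rw [ContinuousWithinAt, hω.diag 0 le_rfl hT.le] at hc
      refine hc.comp (f := fun u : ℝ => ((0 : ℝ), min u T)) (tendsto_nhdsWithin_iff.2 ⟨?_, ?_⟩)
      · have : Continuous fun u : ℝ => ((0 : ℝ), min u T) := by fun_prop
        have h := this.tendsto 0
        simp only [min_eq_left hT.le] at h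
        exact h.mono_left nhdsWithin_le_nhds
      · filter_upwards [self_mem_nhdsWithin] with u hu
        exact ⟨le_rfl, le_min (le_of_lt hu) hT.le, min_le_right _ _⟩
    have h2 := (h1.rpow_const (p := 1 / p) (Or.inr (by positivity))).const_mul N
    simpa [Real.zero_rpow (one_div_pos.2 hp).ne', Real.zero_rpow (inv_pos.2 hp).ne'] using h2
  · rw [zero_mul]
    exact mul_nonneg (mul_nonneg hN (Real.rpow_nonneg (hω0 T' hT'0.le) _))
      (hrem s t hs hst (ht.trans hT'))
  · exact ((hnear s t hs hst (ht.trans hT')).1 a).trans (hle T' s t hT' hs hst ht)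
  · rw [zero_mul, add_zero]
    exact lipschitz_of_sub (A' := id) (fun a b => by simp)
      (fun a b => ((hnear s t hs hst (ht.trans hT')).2 a b).trans
        (mul_le_mul_of_nonneg_right (hle T' s t hT' hs hst ht) (norm_nonneg _))) b a
  · exact (hdef r s t hr hrs hst (ht.trans hT')).1 a

end DavieFamily

/-! ### The Davie expansion is sewable. -/

section DavieFlow

variable {U : Type*} [NormedAddCommGroup U] [NormedSpace ℝ U]
variable {V : Type*} [NormedAddCommGroup V] [NormedSpace ℝ V] [CompleteSpace V]
variable {T p γ K : ℝ} {ω : ℝ → ℝ → ℝ} {f : V → U →L[ℝ] V}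

open Filter Topology

/-- Four-point estimate for the Davie expansion, in terms of the control. -/
theorem davie_four_point (hf : HolderBounds γ K f) (x : RoughPath T p ω U) (hω : IsControl T ω)
    (hp : 0 < p) (hγ : 0 < γ) (hγ1 : γ ≤ 1) {L : ℝ} (hL : 0 ≤ L) :
    ∃ c, ∀ s t, 0 ≤ s → s ≤ t → t ≤ T → ∀ w, ω s t ≤ w → w ≤ 1 → ∀ a b a' b' : V,
      ‖a - a'‖ ≤ L * w ^ ((2 + γ) / p) → ‖b - b'‖ ≤ L * w ^ ((2 + γ) / p) →
      ‖(davie f x t s a - davie f x t s b) - (davie f x t s a' - davie f x t s b')‖ ≤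
        (1 + c * w ^ (1 / p)) * ‖(a - b) - (a' - b')‖ +
        (c * w ^ (1 / p) + c * w ^ ((γ * γ + γ) / p)) * w ^ ((2 + γ) / p) * ‖a' - b'‖ := by
  obtain ⟨C, hC, hx⟩ := x.exists_bound hω hp
  have hK := hf.nonneg
  have hLγ : 0 ≤ L ^ γ := by positivity
  refine ⟨K * C + 2 * (K * K) * C + K * L * C + 7 * (K * K) * L ^ γ * C,
    fun s t hs hst ht w hw hw1 a b a' b' ha hb => ?_⟩
  have hw0 := (hω.nonneg s t hs hst ht).trans hw
  obtain ⟨h1, h2⟩ := hx s t hs hst ht w hw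
  refine (norm_davieStep_four_point hf hγ.le hγ1 h1 h2 a b a' b' ha hb).trans ?_
  -- Exponents: `γ(2 + γ) + 2 = (γ² + γ) + (2 + γ)`. The surplus `γ² + γ > 0` makes this coefficient
  -- small with `w`.
  have hWγ : (L * w ^ ((2 + γ) / p)) ^ γ * (w ^ (1 / p)) ^ 2 =
      L ^ γ * (w ^ ((γ * γ + γ) / p) * w ^ ((2 + γ) / p)) := by
    rw [Real.mul_rpow hL (by positivity), mul_assoc, ← Real.rpow_mul hw0, ← Real.rpow_natCast,
      ← Real.rpow_mul hw0, ← Real.rpow_add' hw0 (by positivity),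
      ← Real.rpow_add' hw0 (by positivity)]
    congr 2
    push_cast
    field_simp
    ring
  have he0 : 0 ≤ w ^ (1 / p) := by positivity
  have he1 : w ^ (1 / p) ≤ 1 := Real.rpow_le_one hw0 hw1 (by positivity)
  have hW0 : 0 ≤ w ^ ((2 + γ) / p) := by positivity
  have hq0 : 0 ≤ w ^ ((γ * γ + γ) / p) := by positivity
  refine add_le_add (mul_le_mul_of_nonneg_right ?_ (norm_nonneg _))
    (mul_le_mul_of_nonneg_right ?_ (norm_nonneg _))
  · set e := w ^ (1 / p)
    have n1 : 2 * (K * K) * (C * e ^ 2) ≤ 2 * (K * K) * C * e := by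
      have := mul_le_mul_of_nonneg_left he1 (by positivity : 0 ≤ 2 * (K * K) * C * e)
      nlinarith
    have n2 : 0 ≤ (K * L * C + 7 * (K * K) * L ^ γ * C) * e := by positivity
    linarith
  · have : K * (L * w ^ ((2 + γ) / p)) * (C * w ^ (1 / p)) +
        7 * (K * K) * (L * w ^ ((2 + γ) / p)) ^ γ * (C * (w ^ (1 / p)) ^ 2) =
        ((K * L * C) * w ^ (1 / p) + (7 * (K * K) * L ^ γ * C) * w ^ ((γ * γ + γ) / p)) *
          w ^ ((2 + γ) / p) := by
      linear_combination 7 * (K * K) * C * hWγ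
    rw [this]
    have n1 : 0 ≤ K * C := by positivity
    have n2 : 0 ≤ 2 * (K * K) * C := by positivity
    have n3 : 0 ≤ K * L * C := by positivity
    have n4 : 0 ≤ 7 * (K * K) * L ^ γ * C := by positivity
    gcongr <;> linarith

/-- The Davie expansion satisfies the assumptions of the sewing construction. -/
theorem exists_isSewable_davie (hf : HolderBounds γ K f) (x : RoughPath T p ω U)
    (hω : IsControl T ω) (hp : 0 < p) (hγp : p - 2 < γ) (hγ : 0 < γ) (hγ1 : γ ≤ 1) :
    ∃ κ d L M B, IsSewable T ω ((2 + γ) / p) κ d L M B (davie f x) := by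
  obtain ⟨N, hN, hnear⟩ := davie_near hf x hω hp
  obtain ⟨M, hM, hdef⟩ := davie_defect hf x hω hp hγ hγ1
  have hθ : 1 < (2 + γ) / p := by rw [one_lt_div hp]; linarith
  set θ := (2 + γ) / p
  -- The order of choices avoids circularity: `2 * (1/2) ^ θ < 1` leaves room for `d`; then `L`
  -- solves the balance with equality; then `c` depends on `L`; `κ` comes last.
  obtain ⟨d, hd0, hd4, hd1⟩ : ∃ d : ℝ, 0 < d ∧ d ≤ 1 / 4 ∧
      (1 / 2 : ℝ) ^ θ * (2 * (1 + d) ^ 2) < 1 := by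
    have hlim : Tendsto (fun d : ℝ => (1 / 2 : ℝ) ^ θ * (2 * (1 + d) ^ 2)) (𝓝[>] 0)
        (𝓝 ((1 / 2 : ℝ) ^ θ * (2 * (1 + 0) ^ 2))) :=
      (Continuous.tendsto (by fun_prop) 0).mono_left nhdsWithin_le_nhds
    have hlt : (1 / 2 : ℝ) ^ θ * (2 * (1 + 0) ^ 2) < 1 := by
      have := Real.rpow_lt_rpow_of_exponent_gt (by norm_num : (0 : ℝ) < 1 / 2) (by norm_num) hθ
      rw [Real.rpow_one] at this
      linarith
    have h4 : ∀ᶠ d : ℝ in 𝓝[>] 0, d ≤ 1 / 4 :=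
      (eventually_le_nhds (by norm_num : (0 : ℝ) < 1 / 4)).filter_mono nhdsWithin_le_nhds
    obtain ⟨d, h1, h2, h3⟩ :=
      ((hlim.eventually_lt_const hlt).and (h4.and self_mem_nhdsWithin)).exists
    exact ⟨d, h3, h2, h1⟩
  set c₀ := (1 / 2 : ℝ) ^ θ * (2 * (1 + d) ^ 2)
  set L := (3 * M + 2) / (1 - c₀)
  have hL : 0 ≤ L := div_nonneg (by linarith) (by linarith)
  have hLeq : L * (1 - c₀) = 3 * M + 2 := div_mul_cancel₀ _ (by linarith)
  obtain ⟨c, hfour⟩ := davie_four_point hf x hω hp hγ hγ1 hL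
  have hp' : 0 < 1 / p := by positivity
  obtain ⟨κ, ⟨hκ1, hκ2, hκ3, hκ4, hκ5⟩, hκ0 : 0 < κ⟩ :=
    (((eventually_mul_rpow_le (c := L) (by linarith : 0 < θ) hd0).and
      ((eventually_mul_rpow_le (c := N) hp' hd0).and
      ((eventually_mul_rpow_le (c := |c|) hp' (lt_min hd0 one_half_pos)).and
      ((eventually_mul_rpow_le (c := |c|) (by positivity : 0 < (γ * γ + γ) / p)
        one_half_pos).and
      (eventually_mul_rpow_le (c := 1) one_pos one_pos))))).and self_mem_nhdsWithin).exists
  rw [one_mul, Real.rpow_one] at hκ5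
  have hsmall : ∀ {k w q ε : ℝ}, |k| * κ ^ q ≤ ε → 0 ≤ q → 0 ≤ w → w ≤ κ → k * w ^ q ≤ ε := by
    intro k w q ε h hq hw hwκ
    refine (mul_le_mul_of_nonneg_right (le_abs_self k) (by positivity)).trans (le_trans ?_ h)
    exact mul_le_mul_of_nonneg_left (Real.rpow_le_rpow hw hwκ hq) (abs_nonneg _)
  refine ⟨κ, d, L, M, N * ω 0 T ^ (1 / p), hθ, hκ0, hd0.le, hd4, hL, hM, hκ1, ?_,
    fun t ht htT => davie_self f x hω hp ht htT, fun s t hs hst ht a => ?_,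
    fun s t hs hst ht hκ a b => ?_, fun s t hs hst ht w hw hwκ a b a' b' ha hb => ?_,
    fun r s t hr hrs hst ht _ a => (hdef r s t hr hrs hst ht).1 a,
    fun r s t hr hrs hst ht _ a b => (hdef r s t hr hrs hst ht).2 a b⟩
  · rw [mul_assoc]
    linarith
  · exact ((hnear s t hs hst ht).1 a).trans (mul_le_mul_of_nonneg_left
      (Real.rpow_le_rpow (hω.nonneg s t hs hst ht) (hω.mono le_rfl hs hst ht le_rfl) hp'.le) hN)
  · refine ((hnear s t hs hst ht).2 a b).trans (mul_le_mul_of_nonneg_right ?_ (norm_nonneg _))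
    exact hsmall (by rwa [abs_of_nonneg hN]) hp'.le (hω.nonneg s t hs hst ht) hκ
  · have hw0 := (hω.nonneg s t hs hst ht).trans hw
    refine (hfour s t hs hst ht w hw (hwκ.trans hκ5) a b a' b' ha hb).trans ?_
    have n1 := hsmall (hκ3.trans (min_le_left _ _)) hp'.le hw0 hwκ
    have n2 := hsmall (hκ3.trans (min_le_right _ _)) hp'.le hw0 hwκ
    have n3 := hsmall hκ4 (by positivity) hw0 hwκ
    refine add_le_add (mul_le_mul_of_nonneg_right (by linarith) (norm_nonneg _))
      (mul_le_mul_of_nonneg_right ?_ (norm_nonneg _))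
    exact mul_le_of_le_one_left (by positivity) (by linarith)

end DavieFlow

end RoughFlow
end

/-! ### The corollary. -/

theorem mainTheorem6 {U V : Type*}
    [NormedAddCommGroup U] [NormedSpace ℝ U] [CompleteSpace U]
    [NormedAddCommGroup V] [NormedSpace ℝ V] [CompleteSpace V]
    (T : ℝ) (hT : 0 < T) (p γ : ℝ) (hp2 : 2 ≤ p) (hp3 : p < 3) (hγ : p - 2 < γ) (hγ1 : γ ≤ 1)
    (ω : ℝ → ℝ → ℝ) (hω : RoughFlow.IsControl T ω) (x : RoughFlow.RoughPath T p ω U)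
    (f : V → U →L[ℝ] V) (hf : RoughFlow.IsHolderClass 2 γ f) :
    RoughFlow.IsAlmostFlow T ω (RoughFlow.remainder p γ) (RoughFlow.davie f x) ∧
    (∃ ψ : ℝ → ℝ → V → V,
      RoughFlow.IsFlow T ψ ∧ RoughFlow.IsLipschitzFamily T ψ ∧
      RoughFlow.SameGalaxy T ω (RoughFlow.remainder p γ) (RoughFlow.davie f x) ψ ∧
      RoughFlow.IteratedConverges T (RoughFlow.davie f x) ψ ∧
      (∀ ψ' : ℝ → ℝ → V → V, RoughFlow.IsFlow T ψ' →
        RoughFlow.SameGalaxy T ω (RoughFlow.remainder p γ) (RoughFlow.davie f x) ψ' →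
        ∀ s ∈ Set.Icc 0 T, ∀ t ∈ Set.Icc 0 T, ψ' t s = ψ t s) ∧
      (∀ χ : ℝ → ℝ → V → V, RoughFlow.IsAlmostFlow T ω (RoughFlow.remainder p γ) χ →
        RoughFlow.SameGalaxy T ω (RoughFlow.remainder p γ) (RoughFlow.davie f x) χ →
        RoughFlow.IteratedConverges T χ ψ)) ∧
    (∃ y : ℝ → V → ℝ → V,
      RoughFlow.IsSolutionManifold T ω (RoughFlow.remainder p γ) (RoughFlow.davie f x) y ∧
      RoughFlow.IsLipschitzManifold T y ∧
      ∀ z : ℝ → V → ℝ → V,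
        RoughFlow.IsSolutionManifold T ω (RoughFlow.remainder p γ) (RoughFlow.davie f x) z →
        ∀ r, 0 ≤ r → r ≤ T → ∀ a, ∀ t, r ≤ t → t ≤ T → z r a t = y r a t) := by
  have hp : 0 < p := by linarith
  have hγ0 : 0 < γ := by linarith
  have hθ : 1 < (2 + γ) / p := by rw [one_lt_div hp]; linarith
  obtain ⟨K, hK⟩ := hf.exists_holderBounds
  obtain ⟨κ, d, L, M, B, hsew⟩ :=
    RoughFlow.exists_isSewable_davie hK x hω hp hγ hγ0 hγ1
  obtain ⟨ψ, hψ, hψL, C, hC⟩ := hsew.exists_flow hω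
  obtain ⟨N, -, hnear⟩ := RoughFlow.davie_near hK x hω hp
  have hψcomp : ∀ r s t, 0 ≤ r → r ≤ s → s ≤ t → t ≤ T → ∀ a, ψ t r a = ψ t s (ψ s r a) :=
    fun r s t hr hrs hst ht a => (congrFun (hψ.comp r ⟨hr, by linarith⟩ s
      ⟨by linarith, by linarith⟩ t ⟨by linarith, ht⟩ (Or.inl ⟨hrs, hst⟩)) a).symm
  -- A Davie solution is within `(C' + C) ω ^ θ` of the local trajectories of `ψ`, hence is one.
  -- Both uniqueness claims reduce to this.
  have huniq : ∀ (r : ℝ) (a : V) (y : ℝ → V), 0 ≤ r →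
      RoughFlow.IsDavieSolution T ω (RoughFlow.remainder p γ) (RoughFlow.davie f x) r a y →
      ∀ t, r ≤ t → t ≤ T → y t = ψ t r a := by
    rintro r a y hr ⟨rfl, C', hC'⟩ t hrt ht
    refine RoughFlow.eq_flow_of_near (C := C' + C) hω hθ hψ hψL hr (fun s t hrs hst ht => ?_) hrt ht
    rw [add_mul]
    exact (norm_sub_le_norm_sub_add_norm_sub _ _ _).trans
      (add_le_add (hC' s t hrs hst ht) (hC s t (hr.trans hrs) hst ht _))
  refine ⟨RoughFlow.isAlmostFlow_davie hK x hω hp hγ0 hγ1 hT,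
    ⟨ψ, hψ, hψL, ⟨C, hC⟩, RoughFlow.iteratedConverges_of_near hω hθ hT.le hψ hψL hC,
      fun ψ' hψ' ⟨C', hC'⟩ => ?_, fun χ _ ⟨C', hC'⟩ => ?_⟩,
    fun r a t => ψ t r a, fun r hr hrT a => ⟨?_, C, fun s t hrs hst ht => ?_⟩, ⟨?_, ?_⟩,
    fun z hz r hr hrT a t hrt ht => huniq r a _ hr (hz r hr hrT a) t hrt ht⟩
  · have hle : ∀ s ∈ Set.Icc 0 T, ∀ t ∈ Set.Icc 0 T, s ≤ t → ψ' t s = ψ t s := by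
      intro s hs t ht hst
      funext a
      refine huniq s a (fun t => ψ' t s a) hs.1 ⟨by simp [hψ'.refl s hs], C',
        fun u v hsu huv hv => ?_⟩ t hst ht.2
      have e : ψ' v s a = ψ' v u (ψ' u s a) := (congrFun (hψ'.comp s hs u
        ⟨hs.1.trans hsu, huv.trans hv⟩ v ⟨by linarith [hs.1], hv⟩ (Or.inl ⟨hsu, huv⟩)) a).symm
      simp only [e]
      rw [norm_sub_rev]
      exact hC' u v (hs.1.trans hsu) huv hv _
    intro s hs t ht
    rcases le_total s t with hst | hst
    · exact hle s hs t ht hst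
    -- Backward maps are inverses of forward ones, which already agree.
    · funext a
      have h1 := (hψ'.inv s hs t ht).2
      have h2 := (hψ.inv t ht s hs).1
      have h3 := (hψ'.inv t ht s hs).2 a
      rw [hle t ht s hs hst] at h3
      rw [← h2 (ψ' t s a), h3]
  · refine RoughFlow.iteratedConverges_of_near (C := C' + C) hω hθ hT.le hψ hψL
      fun s t hs hst ht a => ?_
    rw [add_mul]
    refine (norm_sub_le_norm_sub_add_norm_sub _ (RoughFlow.davie f x t s a) _).trans
      (add_le_add ?_ (hC s t hs hst ht a))
    rw [norm_sub_rev]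
    exact hC' s t hs hst ht a
  · simp [hψ.refl r ⟨hr, hrT⟩]
  · simp only [hψcomp r s t hr hrs hst ht a]
    rw [norm_sub_rev]
    exact hC s t (hr.trans hrs) hst ht _
  · exact fun r hr hrT a => RoughFlow.continuousOn_flow hω (one_div_pos.2 hp)
      (zero_lt_one.trans hθ) hψ (fun s t hs hst ht => (hnear s t hs hst ht).1) hC hr a
  · obtain ⟨Λ, hΛ⟩ := hψL
    refine ⟨Λ, fun r hr hrT a b t hrt ht => ?_⟩
    have := (hΛ r ⟨hr, hrT⟩ t ⟨hr.trans hrt, ht⟩).dist_le_mul a b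
    rwa [dist_eq_norm, dist_eq_norm] at this
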